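/- **Localization game.** Let $G$ be a finite graph and $k\ge 0$ an integer. A robber starts at an arbitrary vertex of $G$ unknown to the cop. In each round the cop chooses a set $W$ of $k$ vertices (possibly a different one in each round, depending on the answers so far) and is told the graph distances from the current position $v$ of the robber to the elements of $W$. The cop wins if the information received so far determines $v$; otherwise the robber moves, unseen, to a neighbour of $v$, and the next round begins (a robber at an isolated vertex stays there). The localization number $\zeta(G)$ is the minimum $k$ for which the cop has a strategy that eventually locates the robber, whatever the robber does. The theorem below holds for this game, and also for the variant in which the robber may remain at his vertex instead of moving. **Theorem.** Let $\omega=\omega(n)\to\infty$ with $\omega=o(\log n)$, and let $p=p(n)\in[0,1]$ satisfy, for all sufficiently large $n$, $$\left(\frac{2\log n+\omega}{n}\right)^{1/2}\le p\le 1-\frac{3\log\log n}{\log n}.$$ Put $\eta=\frac{\log(1/p)}{\log n}$, $q=1-p$ and $\rho=p^2+q^2$. Let $c>0$ be a constant (independent of $n$) such that, for all sufficiently large $n$, $$c<\min\left\{\frac12\left(\frac{\log n-3\log\log n}{\log(1/p)}-1\right),\,1\right\}.$$ Then, with probability tending to $1$ as $n\to\infty$, the binomial random graph $G_{n,p}$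 satisfies $$\left(1-2\eta-\frac{4\log\log n}{\log n}\right)\frac{2\log n}{\log(1/\rho)}\;\le\;\zeta(G_{n,p})\;\le\;(1-c\eta)\,\frac{2\log n}{\log(1/\rho)}.$$ -/

import Mathlib

open Filter Topology Asymptotics

namespace LocalizationGame

variable {V : Type*}

/-- A transcript of the part of the game played so far, the most recent round first: for each
round, the test set chosen by the cop together with the answer, that is, the list of distances
to the elements of the test set. -/
abbrev Transcript (V : Type*) := List (Σ W : Finset V, (W → ℕ∞))

/-- The `W`-signature of a vertex `v`: the graph distances from `v` to the elements of `W`. -/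
noncomputable def signature (G : SimpleGraph V) (W : Finset V) (v : V) : W → ℕ∞ :=
  fun w => G.edist v w

/-- The legal moves of the robber from `v` to `w`. He moves along an edge; if `mayStay` holds he
is also allowed to remain where he is. A robber at an isolated vertex cannot leave it. -/
def Move (mayStay : Prop) (G : SimpleGraph V) (v w : V) : Prop :=
  G.Adj v w ∨ (w = v ∧ (mayStay ∨ ∀ u, ¬ G.Adj v u))

/-- `r t` is the position of the robber in round `t`; the initial position is arbitrary. -/
def IsTrajectory (mayStay : Prop) (G : SimpleGraph V) (r : ℕ → V) : Prop :=
  ∀ t, Move mayStay G (r t) (r (t + 1))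

/-- A strategy of the cop: the next test set as a function of the transcript so far. -/
abbrev Strategy (V : Type*) := Transcript V → Finset V

/-- The transcript of the first `t` rounds (rounds `0, …, t - 1`), when the cop uses the
strategy `σ` and the robber follows the trajectory `r`. -/
noncomputable def transcript (G : SimpleGraph V) (σ : Strategy V) (r : ℕ → V) : ℕ → Transcript V
  | 0 => []
  | t + 1 =>
    ⟨σ (transcript G σ r t), signature G (σ (transcript G σ r t)) (r t)⟩ :: transcript G σ r t

/-- The robber following `r` is located in round `t`: the answers received up to and including
round `t` determine his position in round `t`. -/
def LocatedAt (mayStay : Prop) (G : SimpleGraph V) (σ : Strategy V) (r : ℕ → V) (t : ℕ) : Prop :=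
  ∀ r' : ℕ → V, IsTrajectory mayStay G r' →
    transcript G σ r' (t + 1) = transcript G σ r (t + 1) → r' t = r t

/-- With test sets of size `k`, the cop has a strategy that eventually locates the robber,
whatever the robber does. -/
def CopWins (mayStay : Prop) (G : SimpleGraph V) (k : ℕ) : Prop :=
  ∃ σ : Strategy V, (∀ h, (σ h).card = k) ∧
    ∀ r : ℕ → V, IsTrajectory mayStay G r → ∃ t, LocatedAt mayStay G σ r t

/-- The localization number `ζ(G)`: the minimum size of the test sets with which the cop wins. -/
noncomputable def localizationNumber (mayStay : Prop) (G : SimpleGraph V) : ℕ :=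
  sInf {k | CopWins mayStay G k}

/-- On a finite graph the minimum is over a nonempty set: testing all vertices locates the
robber immediately. -/
theorem copWins_card [Fintype V] (mayStay : Prop) (G : SimpleGraph V) :
    CopWins mayStay G (Fintype.card V) := by
  refine ⟨fun _ => Finset.univ, fun _ => Finset.card_univ, fun r _ => ⟨0, fun r' _ h => ?_⟩⟩
  simp only [transcript, List.cons.injEq, Sigma.mk.injEq, heq_eq_eq, true_and, and_true] at h
  have h0 := congrFun h ⟨r 0, Finset.mem_univ _⟩
  simpa [signature] using h0

end LocalizationGame

/-!
The cop only needs adjacencies: a vertex of the test set that is adjacent to exactly one of `x` and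
`y` (a *separator* of the pair) tells `x` and `y` apart. A typical graph has `(1 + o(1)) 2pq n`
separators for each pair, so a random set of `k` vertices leaves about `|S| ^ 2 * ρ ^ k` ordered
pairs of a given vertex set `S` unseparated, where `ρ = 1 - 2pq`; this holds for all `S` at once, so
the test set may depend on the history of the game.

*Upper bound.* With `k = (1 - cη) 2 log n / log (1/ρ)` one has `ρ ^ k = n ^ (-2) * p ^ (-2c)`.
If `p` is below a constant `ε(c)`, and `C` is the set of possible positions of the robber, then
after his move he is in the closed neighbourhood of `C`, which has at most `4np |C|` elements, and a
good test set splits it into classes with fewer than `|C|` elements, because `p ^ (2 - 2c)` is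
small (`copWins_of_nbhd_small`). Hence the number of possible positions decreases to one. If
`p ≥ ε`, one random test set leaves only boundedly many pairs in the whole graph unseparated. When
`j` of the `k` vertices are kept back, there are `O(2 ^ j)` such pairs, hence classes of size
`O(2 ^ (j / 2))`, and for large constant `j` the extension property provides `j` vertices that
give the members of each class different codes of `j` bits (`copWins_of_extension`). The slack in
these arguments makes `c < 1` sufficient.

*Lower bound.* In a graph of diameter two it is enough that each vertex `v` has, for each small set
`W`, two neighbours outside `W` with the same adjacencies to `W`: the robber moves to one of them,
and the cop cannot exclude the other (`not_copWins_of_confusable`). The rows of the adjacency matrix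
restricted to `W ∪ {v}` are independent samples from a product measure `μ`, and what is needed is a
collision of two samples that contain `v`. If the sum `s` of `μ z ^ 2` over the values `z` that
contain `v` satisfies `m * √s ≥ 1`, then `2m` samples have no such collision with
probability at most `exp (-m√s / 2)` (`sum_no_collision_le`): no such value has probability more
than `√s`, which controls the lower tail of the mass of the values seen in the first `m` samples.
For the `k` in question `n√s` is at least of order `(log n) ^ 4 / p`, which beats the union bound
over the `n ^ (k + 1) = exp (O((log n) ^ 3 / p))` choices of `v` and `W`.
-/

namespace LocalizationGame

/-! ### The game: a criterion for each player -/

section Game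

variable {V : Type*}

theorem exists_move (mayStay : Prop) (G : SimpleGraph V) (v : V) : ∃ w, Move mayStay G v w := by
  by_cases h : ∃ w, G.Adj v w
  · obtain ⟨w, hw⟩ := h
    exact ⟨w, Or.inl hw⟩
  · push Not at h
    exact ⟨v, Or.inr ⟨rfl, Or.inr h⟩⟩

theorem exists_isTrajectory_from (mayStay : Prop) (G : SimpleGraph V) (v : V) :
    ∃ r : ℕ → V, r 0 = v ∧ IsTrajectory mayStay G r := by
  choose f hf using exists_move mayStay G
  refine ⟨fun t => f^[t] v, rfl, fun t => ?_⟩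
  simp only [Function.iterate_succ_apply']
  exact hf _

/-- Every finite initial segment of a trajectory that is legally continued by one step extends to
a trajectory. -/
theorem exists_isTrajectory_extending (mayStay : Prop) (G : SimpleGraph V) (r : ℕ → V)
    (hr : IsTrajectory mayStay G r) (t : ℕ) (y : V) (hy : Move mayStay G (r t) y) :
    ∃ r' : ℕ → V, IsTrajectory mayStay G r' ∧ (∀ s ≤ t, r' s = r s) ∧ r' (t + 1) = y := by
  obtain ⟨f, hf0, hf⟩ := exists_isTrajectory_from mayStay G y
  refine ⟨fun s => if s ≤ t then r s else f (s - (t + 1)), fun s => ?_, fun s hs => if_pos hs, ?_⟩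
  · rcases lt_trichotomy s t with h | h | h
    · simpa [h.le, Nat.succ_le_of_lt h] using hr s
    · subst h
      simpa [hf0] using hy
    · have h1 : ¬ s ≤ t := by omega
      have h2 : ¬ s + 1 ≤ t := by omega
      have h3 : s + 1 - (t + 1) = s - (t + 1) + 1 := by omega
      simp only [h1, h2, if_false, h3]
      exact hf _
  · simp [hf0]

theorem transcript_congr (G : SimpleGraph V) (σ : Strategy V) {r r' : ℕ → V} (t : ℕ)
    (h : ∀ s < t, r s = r' s) : transcript G σ r t = transcript G σ r' t := by
  induction t with
  | zero => rfl
  | succ t ih =>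
    simp only [transcript]
    rw [ih fun s hs => h s (by omega), h t (by omega)]

/-- The robber is never located if each vertex has two neighbours that the next test set does not
separate: he moves to one of them, and the other one remains possible. -/
theorem not_copWins_of_confusable [Nonempty V] (mayStay : Prop) (G : SimpleGraph V) (k : ℕ)
    (h : ∀ v, ∀ W : Finset V, W.card = k →
      ∃ x y, x ≠ y ∧ G.Adj v x ∧ G.Adj v y ∧ signature G W x = signature G W y) :
    ¬ CopWins mayStay G k := by
  rintro ⟨σ, hσ, hwin⟩
  choose! x y hxy hx hy hsig using h
  -- The state of the recursion: the transcript before the round, and the previous position.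
  let v₀ : V := Classical.arbitrary V
  let next : Transcript V × V → Transcript V × V := fun s =>
    (⟨σ s.1, signature G (σ s.1) (x s.2 (σ s.1))⟩ :: s.1, x s.2 (σ s.1))
  let st : ℕ → Transcript V × V := fun t => next^[t] ([], v₀)
  have hst : ∀ t, st (t + 1) = next (st t) := fun t => Function.iterate_succ_apply' _ _ _
  let r : ℕ → V := fun t => (st (t + 1)).2
  have hr' : ∀ t, r t = x (st t).2 (σ (st t).1) := fun t => by
    simp only [r, hst t, next]
  have htr : ∀ t, transcript G σ r t = (st t).1 := by
    intro t
    induction t with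
    | zero => rfl
    | succ t ih => rw [transcript, ih, hr' t, hst t]
  have hr : IsTrajectory mayStay G r := fun t => by
    refine Or.inl ?_
    rw [hr' (t + 1)]
    exact hx _ _ (hσ _)
  obtain ⟨t, ht⟩ := hwin r hr
  -- An alternative trajectory that agrees before round `t` and differs in round `t`.
  obtain ⟨r', hr'tr, hagree, hne⟩ : ∃ r' : ℕ → V, IsTrajectory mayStay G r' ∧
      (∀ s < t, r' s = r s) ∧ r' t = y (st t).2 (σ (st t).1) := by
    cases t with
    | zero =>
      obtain ⟨f, hf0, hf⟩ := exists_isTrajectory_from mayStay G (y (st 0).2 (σ (st 0).1))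
      exact ⟨f, hf, fun s hs => absurd hs (by omega), hf0⟩
    | succ t =>
      obtain ⟨r', h1, h2, h3⟩ := exists_isTrajectory_extending mayStay G r hr t
        (y (st (t + 1)).2 (σ (st (t + 1)).1)) (Or.inl (hy _ _ (hσ _)))
      exact ⟨r', h1, fun s hs => h2 s (by omega), h3⟩
  have h1 := ht r' hr'tr (by
    rw [transcript, transcript, transcript_congr G σ t hagree, hne, hr' t, htr t,
      hsig _ _ (hσ _)])
  rw [hne, hr' t] at h1
  exact hxy _ _ (hσ _) h1.symm

section Finite

variable [Fintype V]

theorem lt_localizationNumber (mayStay : Prop) (G : SimpleGraph V) (k : ℕ)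
    (h : ∀ j ≤ k, ¬ CopWins mayStay G j) : k < localizationNumber mayStay G := by
  by_contra hle
  exact h _ (not_lt.1 hle)
    (Nat.sInf_mem (s := {k | CopWins mayStay G k}) ⟨_, copWins_card mayStay G⟩)

open Classical in
/-- The vertices that the robber can reach from `C` in one move, in either variant of the game. -/
noncomputable def closedNbhd (G : SimpleGraph V) (C : Finset V) : Finset V :=
  Finset.univ.filter fun w => ∃ v ∈ C, w = v ∨ G.Adj v w

theorem Move.mem_closedNbhd {mayStay : Prop} {G : SimpleGraph V} {C : Finset V} {v w : V}
    (h : Move mayStay G v w) (hv : v ∈ C) : w ∈ closedNbhd G C := by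
  simp only [closedNbhd, Finset.mem_filter, Finset.mem_univ, true_and]
  rcases h with h | h
  · exact ⟨v, hv, Or.inr h⟩
  · exact ⟨v, hv, Or.inl h.1⟩

open Classical in
/-- The positions that are possible right after the last answer of the transcript `h` (the cop's
knowledge; before the first round every vertex is possible). -/
noncomputable def possible (G : SimpleGraph V) : Transcript V → Finset V
  | [] => Finset.univ
  | a :: h => (closedNbhd G (possible G h)).filter fun v => signature G a.1 v = a.2

theorem mem_possible (mayStay : Prop) (G : SimpleGraph V) (σ : Strategy V) (r : ℕ → V)
    (hr : IsTrajectory mayStay G r) (t : ℕ) : r t ∈ possible G (transcript G σ r (t + 1)) := by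
  induction t with
  | zero =>
    simp only [transcript, possible, Finset.mem_filter, and_true]
    simp only [closedNbhd, Finset.mem_filter, Finset.mem_univ, true_and]
    exact ⟨_, Or.inl rfl⟩
  | succ t ih =>
    rw [transcript, possible, Finset.mem_filter]
    exact ⟨(hr t).mem_closedNbhd ih, rfl⟩

open Classical in
/-- The cop wins if he can always strictly decrease the number of possible positions. -/
theorem copWins_of_decreasing (mayStay : Prop) (G : SimpleGraph V) (k : ℕ)
    (hk : k ≤ Fintype.card V)
    (h : ∀ C : Finset V, 2 ≤ C.card → ∃ W : Finset V, W.card = k ∧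
      ∀ a : W → ℕ∞, ((closedNbhd G C).filter fun v => signature G W v = a).card < C.card) :
    CopWins mayStay G k := by
  have h' : ∀ C : Finset V, ∃ W : Finset V, W.card = k ∧ (2 ≤ C.card →
      ∀ a : W → ℕ∞, ((closedNbhd G C).filter fun v => signature G W v = a).card < C.card) := by
    intro C
    by_cases hC : 2 ≤ C.card
    · obtain ⟨W, hW, hW'⟩ := h C hC
      exact ⟨W, hW, fun _ => hW'⟩
    · obtain ⟨W, -, hW⟩ := Finset.exists_subset_card_eq (s := (Finset.univ : Finset V)) (n := k)
        (by simpa using hk)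
      exact ⟨W, hW, fun hc => absurd hc hC⟩
  choose w hwk hw using h'
  refine ⟨fun t => w (possible G t), fun _ => hwk _, fun r hr => ?_⟩
  set σ : Strategy V := fun t => w (possible G t)
  set c : ℕ → ℕ := fun t => (possible G (transcript G σ r t)).card
  have hdec : ∀ t, 2 ≤ c t → c (t + 1) < c t := fun t ht => by
    have := hw _ ht (signature G (σ (transcript G σ r t)) (r t))
    simpa only [c, transcript, possible] using this
  obtain ⟨t, ht⟩ : ∃ t, c (t + 1) ≤ 1 := by
    by_contra! hcon
    have hlt : ∀ t, c (t + 1) + t ≤ c 1 := by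
      intro t
      induction t with
      | zero => simp
      | succ t ih =>
        have := hdec (t + 1) (hcon t)
        omega
    have h1 := hlt (c 1)
    have h2 := hcon (c 1)
    omega
  refine ⟨t, fun r' hr' htr => ?_⟩
  have h1 := mem_possible mayStay G σ r' hr' t
  rw [htr] at h1
  exact Finset.card_le_one.1 ht _ h1 _ (mem_possible mayStay G σ r hr t)

end Finite

end Game

/-! ### Rows of the adjacency matrix of the binomial random graph -/

open MeasureTheory

section Rows

variable {V : Type*} [Fintype V] {ι κ : Type*} [Fintype ι] [Fintype κ]

theorem measurableSet_graphs (S : Set (SimpleGraph V)) : MeasurableSet S := by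
  have : MeasurableSingletonClass (SimpleGraph V) := ⟨fun G => by
    have h : ({G} : Set (SimpleGraph V)) = SimpleGraph.edgeSet ⁻¹' {G.edgeSet} := by
      ext H
      simp
    rw [h]
    exact SimpleGraph.measurable_edgeSet (measurableSet_singleton _)⟩
  exact S.toFinite.measurableSet

open Classical in
/-- The rows of the adjacency matrix that are indexed by `u`, restricted to the columns `b`. -/
noncomputable def rows (G : SimpleGraph V) (u : ι → V) (b : κ → V) : ι → κ → Bool :=
  fun i k => decide (G.Adj (u i) (b k))

/-- The probability that independent Bernoulli variables with parameter `p` take the values `z`. -/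
noncomputable def bernoulliWeight (p : ℝ) (z : κ → Bool) : ℝ :=
  ∏ k, if z k then p else 1 - p

theorem bernoulliWeight_nonneg {p : ℝ} (h0 : 0 ≤ p) (h1 : p ≤ 1) (z : κ → Bool) :
    0 ≤ bernoulliWeight p z :=
  Finset.prod_nonneg fun k _ => by split_ifs <;> linarith

theorem sum_bernoulliWeight [DecidableEq κ] (p : ℝ) :
    ∑ z : κ → Bool, bernoulliWeight p z = 1 := by
  simp only [bernoulliWeight]
  rw [← Fintype.prod_sum (fun (_ : κ) (x : Bool) => if x then p else 1 - p)]
  simp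

/-- The entries of a submatrix that avoids the diagonal are independent Bernoulli variables. -/
theorem measureReal_rows_eq (p : unitInterval) (u : ι → V) (b : κ → V)
    (hu : Function.Injective u) (hb : Function.Injective b) (hub : ∀ i k, u i ≠ b k)
    (Z : ι → κ → Bool) :
    (SimpleGraph.binomialRandom V p).real {G | rows G u b = Z}
      = ∏ i, bernoulliWeight (p : ℝ) (Z i) := by
  classical
  have hinj : Function.Injective (fun x : ι × κ => s(u x.1, b x.2)) := by
    rintro ⟨i, k⟩ ⟨i', k'⟩ h
    rcases Sym2.eq_iff.1 h with h | h
    · exact Prod.ext (hu h.1) (hb h.2)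
    · exact absurd h.1 (hub _ _)
  let f : ι × κ ↪ Sym2 V := ⟨_, hinj⟩
  let F : Finset (Sym2 V) := Finset.univ.map f
  let t : Sym2 V → Set Prop := fun e => {P | ∀ x : ι × κ, f x = e → (P ↔ Z x.1 x.2 = true)}
  have hset : (fun P : Sym2 V → Prop => SimpleGraph.fromEdgeSet {e | P e}) ⁻¹'
      {G | rows G u b = Z} = Set.pi (F : Set (Sym2 V)) t := by
    ext P
    simp only [Set.mem_preimage, Set.mem_ofPred_eq, Set.mem_pi, F, t, Finset.coe_map,
      Finset.coe_univ, Set.image_univ, Set.mem_range, forall_exists_index, f,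
      Function.Embedding.coeFn_mk]
    constructor
    · rintro h e x rfl y hy
      cases hinj hy
      rw [← h]
      simp [rows, hub]
    · intro h
      funext i k
      have := h _ (i, k) rfl (i, k) rfl
      simp only at this
      rw [Bool.eq_iff_iff, ← this]
      simp [rows, hub]
  rw [SimpleGraph.binomialRandom_eq_map, ProbabilityTheory.setBernoulli_eq_map,
    Measure.map_map (by fun_prop) (by fun_prop), measureReal_def,
    Measure.map_apply (by fun_prop) (measurableSet_graphs _)]
  have hset' : (SimpleGraph.fromEdgeSet ∘ fun P : Sym2 V → Prop => {e | P e}) ⁻¹'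
      {G | rows G u b = Z} = Set.pi (F : Set (Sym2 V)) t := hset
  rw [hset', Measure.infinitePi_pi _ (fun _ _ => MeasurableSet.of_discrete)]
  simp only [F, Finset.prod_map, bernoulliWeight]
  rw [← Finset.univ_product_univ, Finset.prod_product, ENNReal.toReal_prod]
  refine Finset.prod_congr rfl fun i _ => ?_
  rw [ENNReal.toReal_prod]
  refine Finset.prod_congr rfl fun k _ => ?_
  have ht : t (f (i, k)) = {P | P ↔ Z i k = true} := by
    ext P
    simp only [t, f, Function.Embedding.coeFn_mk, Set.mem_ofPred_eq]
    constructor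
    · intro h
      exact h (i, k) rfl
    · rintro h x hx
      cases hinj (show (fun x : ι × κ => s(u x.1, b x.2)) x
        = (fun x : ι × κ => s(u x.1, b x.2)) (i, k) from hx)
      exact h
  rw [ht]
  cases hZ : Z i k <;> simp [f, hub]

/-- Markov's inequality for a function of independent rows. -/
theorem measureReal_le_sum_rows (p : unitInterval) (u : ι → V) (b : κ → V)
    (hu : Function.Injective u) (hb : Function.Injective b) (hub : ∀ i k, u i ≠ b k)
    (F : (ι → κ → Bool) → ℝ) (hF : ∀ Z, 0 ≤ F Z) (S : Set (SimpleGraph V))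
    (hS : ∀ G ∈ S, 1 ≤ F (rows G u b)) [DecidableEq ι] [DecidableEq κ] :
    (SimpleGraph.binomialRandom V p).real S
      ≤ ∑ Z : ι → κ → Bool, (∏ i, bernoulliWeight (p : ℝ) (Z i)) * F Z := by
  have hcov : S ⊆ ⋃ Z : ι → κ → Bool, S ∩ {G | rows G u b = Z} := fun G hG =>
    Set.mem_iUnion.2 ⟨rows G u b, hG, rfl⟩
  refine (measureReal_mono hcov).trans ((measureReal_iUnion_fintype_le _).trans ?_)
  refine Finset.sum_le_sum fun Z _ => ?_
  have hw : 0 ≤ ∏ i, bernoulliWeight (p : ℝ) (Z i) :=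
    Finset.prod_nonneg fun i _ => bernoulliWeight_nonneg p.2.1 p.2.2 _
  by_cases hZ : 1 ≤ F Z
  · refine (measureReal_mono Set.inter_subset_right).trans ?_
    rw [measureReal_rows_eq p u b hu hb hub]
    exact le_mul_of_one_le_right hw hZ
  · have : S ∩ {G | rows G u b = Z} = ∅ := by
      ext G
      simp only [Set.mem_inter_iff, Set.mem_ofPred_eq, Set.mem_empty_iff_false, iff_false, not_and]
      rintro hG rfl
      exact hZ (hS G hG)
    rw [this]
    simpa using mul_nonneg hw (hF Z)

/-- The exponential moment method for a product of functions of independent rows. -/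
theorem measureReal_le_mul_pow (p : unitInterval) (u : ι → V) (b : κ → V)
    (hu : Function.Injective u) (hb : Function.Injective b) (hub : ∀ i k, u i ≠ b k)
    (c : ℝ) (hc : 0 ≤ c) (g : (κ → Bool) → ℝ) (hg : ∀ z, 0 ≤ g z) (S : Set (SimpleGraph V))
    (hS : ∀ G ∈ S, 1 ≤ c * ∏ i, g (rows G u b i)) [DecidableEq κ] :
    (SimpleGraph.binomialRandom V p).real S
      ≤ c * (∑ z : κ → Bool, bernoulliWeight (p : ℝ) z * g z) ^ Fintype.card ι := by
  classical
  refine (measureReal_le_sum_rows p u b hu hb hub (fun Z => c * ∏ i, g (Z i))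
    (fun Z => mul_nonneg hc (Finset.prod_nonneg fun i _ => hg _)) S hS).trans (le_of_eq ?_)
  rw [← Finset.card_univ, ← Finset.prod_const, Fintype.prod_sum, Finset.mul_sum]
  refine Finset.sum_congr rfl fun Z _ => ?_
  rw [Finset.prod_mul_distrib]
  ring

end Rows

section Collision

variable {R : Type*} [Fintype R] [DecidableEq R]

/-- If `2m` independent samples from the distribution `μ` are taken, it is unlikely that no two of
them coincide in an element of `H`: once the first `m` samples are known, and different, each of
the last `m` has to avoid their total mass, and the mass of a random sample has mean
`∑ z ∈ H, μ z ^ 2`. -/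
theorem sum_no_collision_le (μ : R → ℝ) (hμ : ∀ z, 0 ≤ μ z) (hμ1 : ∑ z, μ z = 1) (H : Finset R)
    (m : ℕ) (s : ℝ) (hs : s = ∑ z ∈ H, μ z ^ 2) (hm : 1 ≤ m * √s) :
    ∑ Z : Fin m ⊕ Fin m → R, (∏ i, μ (Z i)) *
        (if ∀ i j, i ≠ j → Z i = Z j → Z i ∉ H then (1 : ℝ) else 0)
      ≤ (1 - √s / 2) ^ m := by
  have hs0 : 0 ≤ s := hs ▸ Finset.sum_nonneg fun z _ => sq_nonneg _
  have hrpos : 0 < √s := by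
    rcases (Real.sqrt_nonneg s).eq_or_lt with h | h
    · rw [← h] at hm; norm_num at hm
    · exact h
  -- The weight of a sample: its probability if it lies in `H`.
  let w : R → ℝ := fun z => if z ∈ H then μ z else 0
  have hw0 : ∀ z, 0 ≤ w z := fun z => by
    simp only [w]; split_ifs
    exacts [hμ z, le_rfl]
  have hwr : ∀ z, w z ≤ √s := fun z => by
    simp only [w]; split_ifs with hz
    · apply Real.le_sqrt_of_sq_le
      rw [hs]
      exact Finset.single_le_sum (f := fun z => μ z ^ 2) (fun z _ => sq_nonneg _) hz
    · exact Real.sqrt_nonneg s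
  -- Given the first `m` samples `a`: either they already collide, or the last `m` samples have to
  -- avoid the mass `∑ i, w (a i)`.
  have hsecond : ∀ a : Fin m → R,
      ∑ a' : Fin m → R, (∏ j, μ (a' j)) *
        (if ∀ i j, i ≠ j → Sum.elim a a' i = Sum.elim a a' j → Sum.elim a a' i ∉ H
          then (1 : ℝ) else 0)
      ≤ ∏ i, Real.exp (-(w (a i) / √s)) := by
    intro a
    by_cases hd : ∀ i j, i ≠ j → a i = a j → a i ∉ H
    · have hmass : ∑ z ∈ H.filter (fun z => ∃ i, a i = z), μ z = ∑ i, w (a i) := by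
        have h1 : H.filter (fun z => ∃ i, a i = z)
            = (Finset.univ.filter fun i => a i ∈ H).image a := by
          ext z
          simp only [Finset.mem_filter, Finset.mem_image, Finset.mem_univ, true_and]
          constructor
          · rintro ⟨hz, i, rfl⟩
            exact ⟨i, hz, rfl⟩
          · rintro ⟨i, hi, rfl⟩
            exact ⟨hi, i, rfl⟩
        rw [h1, Finset.sum_image, Finset.sum_filter]
        intro i hi j _ hij
        by_contra hne
        exact hd i j hne hij (Finset.mem_filter.1 hi).2
      calc _ ≤ ∑ a' : Fin m → R, ∏ j, (μ (a' j) *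
            (if a' j ∈ H.filter (fun z => ∃ i, a i = z) then 0 else 1)) := by
            refine Finset.sum_le_sum fun a' _ => ?_
            rw [Finset.prod_mul_distrib]
            refine mul_le_mul_of_nonneg_left ?_ (Finset.prod_nonneg fun j _ => hμ _)
            split_ifs with h
            · refine (Finset.prod_eq_one fun j _ => ?_).ge
              rw [if_neg]
              intro hj
              obtain ⟨hjH, i, hi⟩ := Finset.mem_filter.1 hj
              exact h (Sum.inl i) (Sum.inr j) (by simp) hi (by simpa [hi] using hjH)
            · exact Finset.prod_nonneg fun j _ => by split_ifs <;> norm_num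
        _ = (1 - ∑ i, w (a i)) ^ m := by
            rw [← Fintype.prod_sum (fun (_ : Fin m) z => μ z *
              (if z ∈ H.filter (fun z => ∃ i, a i = z) then 0 else 1)), Finset.prod_const,
              Finset.card_univ, Fintype.card_fin, ← hmass]
            congr 1
            rw [eq_sub_iff_add_eq]
            conv_rhs => rw [← hμ1]
            conv_lhs =>
              rw [← Finset.univ_inter (H.filter _), ← Finset.sum_ite_mem, Finset.univ_inter]
            rw [← Finset.sum_add_distrib]
            refine Finset.sum_congr rfl fun z _ => ?_
            by_cases hz : z ∈ H.filter (fun z => ∃ i, a i = z)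
            · simp only [if_pos hz, mul_zero, zero_add]
            · simp only [if_neg hz, mul_one, add_zero]
        _ ≤ Real.exp (-(∑ i, w (a i))) ^ m := by
            refine pow_le_pow_left₀ ?_ (by linarith [Real.add_one_le_exp (-(∑ i, w (a i)))]) m
            rw [← hmass, ← hμ1, sub_nonneg]
            exact Finset.sum_le_sum_of_subset_of_nonneg (Finset.subset_univ _) fun z _ _ => hμ z
        _ ≤ ∏ i, Real.exp (-(w (a i) / √s)) := by
            rw [← Real.exp_nat_mul, ← Real.exp_sum, Finset.sum_neg_distrib, ← Finset.sum_div]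
            apply Real.exp_le_exp.2
            have h0 : 0 ≤ ∑ i, w (a i) := Finset.sum_nonneg fun i _ => hw0 _
            have h1 : (∑ i, w (a i)) / √s ≤ (∑ i, w (a i)) * m := by
              rw [div_le_iff₀ hrpos, mul_assoc]
              exact le_mul_of_one_le_right h0 hm
            linarith
    · refine (Finset.sum_eq_zero fun a' _ => ?_).trans_le
        (Finset.prod_nonneg fun i _ => (Real.exp_pos _).le)
      rw [if_neg, mul_zero]
      intro h
      refine hd fun i j hij he => ?_
      simpa using h (Sum.inl i) (Sum.inl j) (by simpa using hij) he
  calc _ = ∑ a : Fin m → R, (∏ i, μ (a i)) * ∑ a' : Fin m → R, (∏ j, μ (a' j)) *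
        (if ∀ i j, i ≠ j → Sum.elim a a' i = Sum.elim a a' j → Sum.elim a a' i ∉ H
          then (1 : ℝ) else 0) := by
        rw [← (Equiv.sumArrowEquivProdArrow (Fin m) (Fin m) R).symm.sum_comp,
          Fintype.sum_prod_type]
        refine Finset.sum_congr rfl fun a _ => ?_
        rw [Finset.mul_sum]
        refine Finset.sum_congr rfl fun a' _ => ?_
        rw [← mul_assoc, Fintype.prod_sum_type]
        rfl
    _ ≤ ∑ a : Fin m → R, (∏ i, μ (a i)) * ∏ i, Real.exp (-(w (a i) / √s)) :=
        Finset.sum_le_sum fun a _ => mul_le_mul_of_nonneg_left (hsecond a)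
          (Finset.prod_nonneg fun i _ => hμ _)
    _ = (∑ z, μ z * Real.exp (-(w z / √s))) ^ m := by
        simp_rw [← Finset.prod_mul_distrib]
        rw [← Fintype.prod_sum (fun (_ : Fin m) z => μ z * Real.exp (-(w z / √s))),
          Finset.prod_const, Finset.card_univ, Fintype.card_fin]
    _ ≤ (1 - √s / 2) ^ m := by
        refine pow_le_pow_left₀ (Finset.sum_nonneg fun z _ =>
          mul_nonneg (hμ z) (Real.exp_pos _).le) ?_ m
        calc _ ≤ ∑ z, (μ z - μ z * w z / (2 * √s)) := by
              refine Finset.sum_le_sum fun z _ => ?_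
              have hx0 : 0 ≤ w z / √s := div_nonneg (hw0 z) hrpos.le
              have hx1 : w z / √s ≤ 1 := (div_le_one hrpos).2 (hwr z)
              have : Real.exp (-(w z / √s)) ≤ 1 - (w z / √s) / 2 := by
                rw [Real.exp_neg, inv_le_comm₀ (Real.exp_pos _) (by linarith)]
                refine le_trans ?_ (Real.add_one_le_exp _)
                rw [inv_le_iff_one_le_mul₀ (by linarith)]
                nlinarith
              calc _ ≤ μ z * (1 - (w z / √s) / 2) := mul_le_mul_of_nonneg_left this (hμ z)
                _ = _ := by field_simp
          _ = 1 - √s / 2 := by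
              rw [Finset.sum_sub_distrib, hμ1, ← Finset.sum_div]
              have : ∑ z, μ z * w z = s := by
                simp only [w, mul_ite, mul_zero, Finset.sum_ite_mem, Finset.univ_inter, hs, sq]
              rw [this]
              have h2 : √s * √s = s := Real.mul_self_sqrt hs0
              congr 1
              rw [div_eq_div_iff (by positivity) two_ne_zero]
              linear_combination -2 * h2

end Collision

/-! ### Probabilities of the exceptional events -/

section Events

open MeasureTheory

variable {V : Type*} [Fintype V]

theorem sum_bool_fun (f : (Bool → Bool) → ℝ) :
    ∑ z, f z = ∑ a, ∑ b, f (fun c => cond c a b) := by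
  rw [← (Equiv.boolArrowEquivProd Bool).symm.sum_comp, Fintype.sum_prod_type]
  rw [Fintype.sum_bool, Fintype.sum_bool, Fintype.sum_bool, Fintype.sum_bool, Fintype.sum_bool,
    Fintype.sum_bool]
  have h : ∀ a b, (Equiv.boolArrowEquivProd Bool).symm (a, b) = fun c => cond c b a := by
    intro a b; funext c; cases c <;> rfl
  simp only [h]
  ring

theorem bernoulliWeight_cond (p : ℝ) (a b : Bool) :
    bernoulliWeight p (fun c => cond c a b)
      = (if a then p else 1 - p) * (if b then p else 1 - p) := by
  simp [bernoulliWeight]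

open Classical in
theorem card_ne_pair {x y : V} (hxy : x ≠ y) :
    Fintype.card {w : V // w ≠ x ∧ w ≠ y} = Fintype.card V - 2 := by
  rw [Fintype.card_subtype]
  have : (Finset.univ.filter fun w => w ≠ x ∧ w ≠ y) = Finset.univ \ {x, y} := by
    ext w; simp
  rw [this, Finset.card_sdiff_of_subset (Finset.subset_univ _), Finset.card_pair hxy,
    Finset.card_univ]

theorem injective_cond {α : Type*} {x y : α} (hxy : x ≠ y) :
    Function.Injective (fun c : Bool => cond c x y) := by
  intro c c' h
  cases c <;> cases c' <;> simp_all [eq_comm]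

theorem measureReal_no_common_neighbor_le (p : unitInterval) {x y : V} (hxy : x ≠ y) :
    (SimpleGraph.binomialRandom V p).real {G | ∀ w, ¬ (G.Adj w x ∧ G.Adj w y)}
      ≤ (1 - (p : ℝ) ^ 2) ^ (Fintype.card V - 2) := by
  classical
  rw [← card_ne_pair hxy]
  refine (measureReal_le_mul_pow p (Subtype.val : {w : V // w ≠ x ∧ w ≠ y} → V)
    (fun c => cond c x y) Subtype.val_injective (injective_cond hxy)
    (fun i c => by cases c <;> simp [i.2.1, i.2.2]) 1 zero_le_one
    (fun z => if z true && z false then 0 else 1) (fun z => by split_ifs <;> norm_num) _ ?_).trans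
      (le_of_eq ?_)
  · intro G hG
    rw [one_mul, Finset.prod_eq_one]
    intro i _
    rw [if_neg]
    simpa [rows] using hG i.1
  · rw [one_mul, sum_bool_fun]
    simp only [bernoulliWeight_cond, Fintype.sum_bool]
    simp
    ring

open Classical in
/-- The vertices adjacent to exactly one of `x` and `y`. -/
noncomputable def separators (G : SimpleGraph V) (x y : V) : Finset V :=
  Finset.univ.filter fun w => ¬ (G.Adj x w ↔ G.Adj y w)

/-- Lower tail bound for the number of vertices that separate `x` and `y`. -/
theorem measureReal_card_separators_le (p : unitInterval) {x y : V} (hxy : x ≠ y) (D t : ℝ)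
    (ht : 0 ≤ t) :
    (SimpleGraph.binomialRandom V p).real {G | ((separators G x y).card : ℝ) ≤ D}
      ≤ Real.exp (t * D) *
        (1 - 2 * p * (1 - p) * (1 - Real.exp (-t))) ^ (Fintype.card V - 2) := by
  classical
  rw [← card_ne_pair hxy]
  refine (measureReal_le_mul_pow p (Subtype.val : {w : V // w ≠ x ∧ w ≠ y} → V)
    (fun c => cond c x y) Subtype.val_injective (injective_cond hxy)
    (fun i c => by cases c <;> simp [i.2.1, i.2.2]) _ (Real.exp_pos (t * D)).le
    (fun z => if z true = z false then 1 else Real.exp (-t))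
    (fun z => by split_ifs <;> positivity) _ ?_).trans (le_of_eq ?_)
  · intro G hG
    have hG' : ((separators G x y).card : ℝ) ≤ D := hG
    rw [Finset.prod_ite, Finset.prod_const_one, one_mul, Finset.prod_const, ← Real.exp_nat_mul,
      ← Real.exp_add, Real.one_le_exp_iff]
    have hle : ((Finset.univ.filter fun i : {w : V // w ≠ x ∧ w ≠ y} =>
        ¬ rows G Subtype.val (fun c => cond c x y) i true
          = rows G Subtype.val (fun c => cond c x y) i false).card : ℝ) ≤ D := by
      refine le_trans (Nat.cast_le.2 ?_) hG'
      rw [← Finset.card_map (Function.Embedding.subtype _)]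
      refine Finset.card_le_card fun w hw => ?_
      obtain ⟨i, hi, rfl⟩ := Finset.mem_map.1 hw
      simpa [rows, separators, G.adj_comm] using hi
    nlinarith
  · congr 2
    rw [sum_bool_fun]
    simp only [bernoulliWeight_cond, Fintype.sum_bool]
    simp
    ring

open Classical in
/-- Upper tail bound for the degrees. -/
theorem measureReal_le_degree (p : unitInterval) (x : V) (D : ℝ) :
    (SimpleGraph.binomialRandom V p).real
        {G | D ≤ ((Finset.univ.filter fun w => G.Adj x w).card : ℝ)}
      ≤ Real.exp (2 * (p * Fintype.card V) - D) := by
  refine (measureReal_le_mul_pow p (Subtype.val : {w : V // w ≠ x} → V)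
    (fun _ : Unit => x) Subtype.val_injective (fun _ _ _ => rfl)
    (fun i _ => i.2) _ (Real.exp_pos (-D)).le
    (fun z => if z () = true then Real.exp 1 else 1)
    (fun z => by split_ifs <;> positivity) _ ?_).trans ?_
  · intro G hG
    have hG' : D ≤ ((Finset.univ.filter fun w => G.Adj x w).card : ℝ) := hG
    rw [Finset.prod_ite, Finset.prod_const_one, mul_one, Finset.prod_const, ← Real.exp_nat_mul,
      ← Real.exp_add, Real.one_le_exp_iff]
    have hle : D ≤ ((Finset.univ.filter fun i : {w : V // w ≠ x} =>
        rows G Subtype.val (fun _ : Unit => x) i () = true).card : ℝ) := by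
      refine le_trans hG' (Nat.cast_le.2 ?_)
      rw [← Finset.card_map (Function.Embedding.subtype _)]
      refine Finset.card_le_card fun w hw => ?_
      have hw' : G.Adj x w := (Finset.mem_filter.1 hw).2
      exact Finset.mem_map.2 ⟨⟨w, hw'.ne'⟩, by simpa [rows] using hw'.symm, rfl⟩
    linarith
  · have hsum : ∑ z : Unit → Bool, bernoulliWeight (p : ℝ) z *
        (if z () = true then Real.exp 1 else 1) = 1 + p * (Real.exp 1 - 1) := by
      rw [← (Equiv.funUnique Unit Bool).symm.sum_comp, Fintype.sum_bool]
      simp [bernoulliWeight]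
      ring
    rw [hsum]
    have hp0 : (0 : ℝ) ≤ p := p.2.1
    have he : Real.exp 1 ≤ 3 := Real.exp_one_lt_three.le
    have h1 : 1 + (p : ℝ) * (Real.exp 1 - 1) ≤ Real.exp (2 * p) := by
      refine le_trans ?_ (Real.add_one_le_exp _)
      nlinarith
    have h0 : 0 ≤ 1 + (p : ℝ) * (Real.exp 1 - 1) := by
      have := Real.one_le_exp (zero_le_one' ℝ)
      have := mul_nonneg hp0 (sub_nonneg.2 this)
      linarith
    calc _ ≤ Real.exp (-D) * Real.exp (2 * p) ^ Fintype.card {w : V // w ≠ x} := by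
          gcongr
      _ ≤ Real.exp (-D) * Real.exp (2 * p) ^ Fintype.card V := by
          refine mul_le_mul_of_nonneg_left (pow_le_pow_right₀ ?_ ?_) (Real.exp_pos _).le
          · rw [Real.one_le_exp_iff]; positivity
          · exact Fintype.card_subtype_le _
      _ = _ := by
          rw [← Real.exp_nat_mul, ← Real.exp_add]
          ring_nf

theorem pow_card_le_bernoulliWeight {κ : Type*} [Fintype κ] {p μ : ℝ} (hμ : 0 ≤ μ) (hμp : μ ≤ p)
    (hμq : μ ≤ 1 - p) (z : κ → Bool) : μ ^ Fintype.card κ ≤ bernoulliWeight p z := by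
  rw [← Finset.card_univ, ← Finset.prod_const]
  refine Finset.prod_le_prod (fun _ _ => hμ) fun k _ => ?_
  split_ifs <;> assumption

/-- The probability that no vertex has the adjacencies to `B` that are prescribed by `A`. -/
theorem measureReal_no_extension_le (p : unitInterval) (B A : Finset V) (μ : ℝ)
    (hμ : 0 ≤ μ) (hμp : μ ≤ p) (hμq : μ ≤ 1 - p) :
    (SimpleGraph.binomialRandom V p).real {G | ¬ ∃ w, ∀ x ∈ B, G.Adj x w ↔ x ∈ A}
      ≤ (1 - μ ^ B.card) ^ (Fintype.card V - B.card) := by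
  classical
  have hcard : Fintype.card {w : V // w ∉ B} = Fintype.card V - B.card := by
    rw [Fintype.card_subtype_compl, Fintype.card_coe]
  rw [← hcard]
  refine (measureReal_le_mul_pow p (Subtype.val : {w : V // w ∉ B} → V)
    (Subtype.val : B → V) Subtype.val_injective Subtype.val_injective
    (fun i k h => i.2 (h ▸ k.2)) 1 zero_le_one
    (fun z => if z = (fun k : B => decide (k.1 ∈ A)) then 0 else 1)
    (fun z => by split_ifs <;> norm_num) _ ?_).trans ?_
  · intro G hG
    rw [one_mul, Finset.prod_eq_one]
    intro i _
    rw [if_neg]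
    intro h
    refine hG ⟨i.1, fun x hx => ?_⟩
    have := congrFun h ⟨x, hx⟩
    simpa [rows, G.adj_comm] using this
  · rw [one_mul]
    have hnn : ∀ z : B → Bool, 0 ≤ bernoulliWeight (p : ℝ) z :=
      bernoulliWeight_nonneg p.2.1 p.2.2
    refine pow_le_pow_left₀ (Finset.sum_nonneg fun z _ => mul_nonneg (hnn z)
      (by split_ifs <;> norm_num)) ?_ _
    have h1 := pow_card_le_bernoulliWeight (κ := B) hμ hμp hμq (fun k => decide (k.1 ∈ A))
    rw [Fintype.card_coe] at h1
    set a : B → Bool := fun k => decide (k.1 ∈ A)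
    have h2 : ∑ z : B → Bool, bernoulliWeight (p : ℝ) z * (if z = a then 0 else 1)
        = 1 - bernoulliWeight (p : ℝ) a := by
      have h3 := sum_bernoulliWeight (κ := B) (p : ℝ)
      rw [← Finset.add_sum_erase _ _ (Finset.mem_univ a)] at h3 ⊢
      rw [if_pos rfl, mul_zero, zero_add, eq_sub_iff_add_eq']
      refine Eq.trans ?_ h3
      congr 1
      refine Finset.sum_congr rfl fun z hz => ?_
      rw [if_neg (Finset.ne_of_mem_erase hz), mul_one]
    rw [h2]
    linarith

/-- The collision probability of the rows that have a `1` in column `v`. -/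
theorem sum_sq_bernoulliWeight {κ : Type*} [Fintype κ] [DecidableEq κ] (p : ℝ) (v : κ) :
    ∑ z ∈ Finset.univ.filter (fun z : κ → Bool => z v = true), bernoulliWeight p z ^ 2
      = p ^ 2 * (p ^ 2 + (1 - p) ^ 2) ^ (Fintype.card κ - 1) := by
  have h : ∀ z : κ → Bool, (if z v = true then bernoulliWeight p z ^ 2 else 0)
      = ∏ k, (if k = v then (if z k then p ^ 2 else 0)
        else (if z k then p ^ 2 else (1 - p) ^ 2)) := by
    intro z
    rw [← Finset.mul_prod_erase _ _ (Finset.mem_univ v), if_pos rfl]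
    split_ifs with hz
    · rw [bernoulliWeight, ← Finset.prod_pow, ← Finset.mul_prod_erase _ _ (Finset.mem_univ v),
        if_pos hz]
      congr 1
      refine Finset.prod_congr rfl fun k hk => ?_
      rw [if_neg (Finset.ne_of_mem_erase hk)]
      split_ifs <;> rfl
    · rw [zero_mul]
  rw [Finset.sum_filter, Finset.sum_congr rfl fun z _ => h z,
    ← Fintype.prod_sum (fun k (x : Bool) => (if k = v then (if x then p ^ 2 else 0)
        else (if x then p ^ 2 else (1 - p) ^ 2) : ℝ)),
    ← Finset.mul_prod_erase _ _ (Finset.mem_univ v)]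
  congr 1
  · simp
  · rw [← Finset.card_univ, ← Finset.card_erase_of_mem (Finset.mem_univ v), ← Finset.prod_const]
    refine Finset.prod_congr rfl fun k hk => ?_
    simp [Finset.ne_of_mem_erase hk]

/-- With high probability two neighbours of `v` outside `W` have the same adjacencies to `W`. -/
theorem measureReal_no_twins_le (p : unitInterval) (v : V) (W : Finset V) (m : ℕ) (r : ℝ)
    (hr2 : r ^ 2 ≤ (p : ℝ) ^ 2 * ((p : ℝ) ^ 2 + (1 - p) ^ 2) ^ W.card)
    (hm : 1 ≤ m * r) (hcard : 2 * m + W.card + 1 ≤ Fintype.card V) :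
    (SimpleGraph.binomialRandom V p).real
        {G | ¬ ∃ x y, x ≠ y ∧ x ∉ W ∧ y ∉ W ∧ G.Adj v x ∧ G.Adj v y ∧
          ∀ w ∈ W, G.Adj x w ↔ G.Adj y w}
      ≤ Real.exp (-(m * r / 2)) := by
  classical
  set B : Finset V := insert v W with hB
  have hBcard : B.card ≤ W.card + 1 := Finset.card_insert_le _ _
  have hfree : Fintype.card (Fin m ⊕ Fin m) ≤ Fintype.card {w : V // w ∉ B} := by
    rw [Fintype.card_subtype_compl, Fintype.card_coe, Fintype.card_sum, Fintype.card_fin]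
    omega
  obtain ⟨f⟩ := Function.Embedding.nonempty_of_card_le hfree
  let v' : B := ⟨v, Finset.mem_insert_self _ _⟩
  set H : Finset (B → Bool) := Finset.univ.filter fun z => z v' = true with hH
  set s : ℝ := ∑ z ∈ H, bernoulliWeight (p : ℝ) z ^ 2 with hs
  have hρ1 : (p : ℝ) ^ 2 + (1 - p) ^ 2 ≤ 1 := by
    nlinarith [p.2.1, p.2.2, mul_nonneg p.2.1 (sub_nonneg.2 p.2.2)]
  have hrs : r ≤ √s := by
    apply Real.le_sqrt_of_sq_le
    rw [hs, hH, sum_sq_bernoulliWeight, Fintype.card_coe]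
    refine hr2.trans ?_
    gcongr ?_ * ?_
    exact pow_le_pow_of_le_one (by positivity) hρ1 (by omega)
  have hms : 1 ≤ m * √s := hm.trans (by gcongr)
  have hmain := measureReal_le_sum_rows p (fun i => (f i).1) (Subtype.val : B → V)
    (Subtype.val_injective.comp f.injective) Subtype.val_injective
    (fun i k h => (f i).2 (h ▸ k.2))
    (fun Z => if ∀ i j, i ≠ j → Z i = Z j → Z i ∉ H then (1 : ℝ) else 0)
    (fun Z => by positivity)
    {G | ¬ ∃ x y, x ≠ y ∧ x ∉ W ∧ y ∉ W ∧ G.Adj v x ∧ G.Adj v y ∧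
          ∀ w ∈ W, G.Adj x w ↔ G.Adj y w} (by
      intro G hG
      rw [if_pos]
      intro i j hij hrow hiH
      have hi : G.Adj v (f i).1 := by
        have := (Finset.mem_filter.1 hiH).2
        simpa [rows, v', G.adj_comm] using this
      refine hG ⟨(f i).1, (f j).1, fun h => hij (f.injective (Subtype.ext h)),
        fun h => (f i).2 (Finset.mem_insert_of_mem h),
        fun h => (f j).2 (Finset.mem_insert_of_mem h), hi, ?_, fun w hw => ?_⟩
      · rw [hrow] at hiH
        have := (Finset.mem_filter.1 hiH).2
        simpa [rows, v', G.adj_comm] using this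
      · have := congrFun hrow ⟨w, Finset.mem_insert_of_mem hw⟩
        simpa [rows] using this)
  refine hmain.trans ((sum_no_collision_le _ (bernoulliWeight_nonneg p.2.1 p.2.2)
    (sum_bernoulliWeight _) H m s hs hms).trans ?_)
  have hs1 : √s ≤ 1 := by
    rw [Real.sqrt_le_one, hs, hH, sum_sq_bernoulliWeight]
    exact mul_le_one₀ (pow_le_one₀ p.2.1 p.2.2) (by positivity) (pow_le_one₀ (by positivity) hρ1)
  calc (1 - √s / 2) ^ m ≤ Real.exp (-(r / 2)) ^ m := by
        refine pow_le_pow_left₀ (by linarith) ?_ m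
        linarith [Real.add_one_le_exp (-(r / 2))]
    _ = _ := by
        rw [← Real.exp_nat_mul]
        ring_nf

end Events

/-! ### Strategies for the cop from random test sets -/

section Separation

variable {V : Type*}

theorem adj_iff_of_signature_eq {G : SimpleGraph V} {W : Finset V} {x y : V}
    (h : signature G W x = signature G W y) : ∀ w ∈ W, G.Adj x w ↔ G.Adj y w := by
  intro w hw
  have := congrFun h ⟨w, hw⟩
  simp only [signature] at this
  rw [← SimpleGraph.edist_eq_one_iff_adj, ← SimpleGraph.edist_eq_one_iff_adj, this]

open Classical in
/-- The ordered pairs of distinct vertices of `S` that have the same adjacencies to `W`. -/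
noncomputable def unseparated (G : SimpleGraph V) (S W : Finset V) : Finset (V × V) :=
  (S ×ˢ S).filter fun e => e.1 ≠ e.2 ∧ ∀ w ∈ W, G.Adj e.1 w ↔ G.Adj e.2 w

theorem mem_unseparated {G : SimpleGraph V} {S W : Finset V} {e : V × V} :
    e ∈ unseparated G S W ↔
      (e.1 ∈ S ∧ e.2 ∈ S) ∧ e.1 ≠ e.2 ∧ ∀ w ∈ W, G.Adj e.1 w ↔ G.Adj e.2 w := by
  simp only [unseparated, Finset.mem_filter, Finset.mem_product]

theorem unseparated_anti (G : SimpleGraph V) (S : Finset V) {W W' : Finset V} (h : W ⊆ W') :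
    unseparated G S W' ⊆ unseparated G S W := by
  intro e he
  rw [mem_unseparated] at he ⊢
  exact ⟨he.1, he.2.1, fun w hw => he.2.2 w (h hw)⟩

/-- A class of `m` vertices that are not told apart contributes `m * (m - 1)` unseparated pairs. -/
theorem card_mul_pred_le_card_unseparated (G : SimpleGraph V) {S T W : Finset V} (hTS : T ⊆ S)
    (hT : ∀ x ∈ T, ∀ y ∈ T, ∀ w ∈ W, G.Adj x w ↔ G.Adj y w) :
    T.card * (T.card - 1) ≤ (unseparated G S W).card := by
  classical
  have h : T.offDiag ⊆ unseparated G S W := by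
    intro e he
    obtain ⟨h1, h2, h3⟩ := Finset.mem_offDiag.1 he
    exact mem_unseparated.2 ⟨⟨hTS h1, hTS h2⟩, h3, hT _ h1 _ h2⟩
  have := Finset.card_le_card h
  rwa [Finset.offDiag_card, ← Nat.mul_sub_one] at this

variable [Fintype V]

/-- A good test set exists by averaging over a uniformly random sequence of `k` vertices. -/
theorem exists_card_unseparated_le [Nonempty V] (G : SimpleGraph V) (S : Finset V) (k : ℕ)
    (hk : k ≤ Fintype.card V) (d : ℝ) (hdn : d ≤ Fintype.card V)
    (hd : ∀ x y, x ≠ y → d ≤ ((separators G x y).card : ℝ)) :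
    ∃ W : Finset V, W.card = k ∧
      ((unseparated G S W).card : ℝ) ≤ (S.card : ℝ) ^ 2 * (1 - d / Fintype.card V) ^ k := by
  classical
  set n := Fintype.card V with hn
  have hnpos : (0 : ℝ) < n := Nat.cast_pos.2 Fintype.card_pos
  have hpair : ∀ e ∈ S ×ˢ S, (((Finset.univ : Finset (Fin k → V)).filter fun f =>
      e ∈ unseparated G S (Finset.univ.image f)).card : ℝ) ≤ (n - d) ^ k := by
    intro e he
    by_cases hne : e.1 = e.2
    · rw [Finset.filter_false_of_mem]
      · simpa using pow_nonneg (sub_nonneg.2 hdn) k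
      · intro f _ h
        exact (mem_unseparated.1 h).2.1 hne
    · have hsub : ((Finset.univ : Finset (Fin k → V)).filter fun f =>
          e ∈ unseparated G S (Finset.univ.image f))
          ⊆ Fintype.piFinset fun _ => (separators G e.1 e.2)ᶜ := by
        intro f hf
        have hf' := (mem_unseparated.1 (Finset.mem_filter.1 hf).2).2.2
        rw [Fintype.mem_piFinset]
        intro i
        simpa [separators] using hf' (f i) (Finset.mem_image_of_mem f (Finset.mem_univ i))
      refine (Nat.cast_le.2 (Finset.card_le_card hsub)).trans ?_
      rw [Fintype.card_piFinset_const, Nat.cast_pow, Finset.card_compl,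
        Nat.cast_sub (Finset.card_le_univ _)]
      refine pow_le_pow_left₀ (sub_nonneg.2 (Nat.cast_le.2 (Finset.card_le_univ _))) ?_ k
      have := hd _ _ hne
      linarith
  have hsum : ∑ f : Fin k → V, ((unseparated G S (Finset.univ.image f)).card : ℝ)
      ≤ ∑ _f : Fin k → V, (S.card : ℝ) ^ 2 * (1 - d / n) ^ k := by
    have h1 : ∀ f : Fin k → V, ((unseparated G S (Finset.univ.image f)).card : ℝ)
        = ∑ e ∈ S ×ˢ S, if e ∈ unseparated G S (Finset.univ.image f) then (1 : ℝ) else 0 := by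
      intro f
      rw [Finset.sum_ite_mem, Finset.sum_const, nsmul_one]
      congr 2
      exact (Finset.inter_eq_right.2 fun e he =>
        Finset.mem_product.2 (mem_unseparated.1 he).1).symm
    simp_rw [h1]
    rw [Finset.sum_comm]
    calc _ ≤ ∑ _e ∈ S ×ˢ S, ((n : ℝ) - d) ^ k := by
          refine Finset.sum_le_sum fun e he => ?_
          rw [← Finset.sum_filter, Finset.sum_const, nsmul_one]
          exact hpair e he
      _ = _ := by
          rw [Finset.sum_const, Finset.sum_const, Finset.card_product, Finset.card_univ,
            Fintype.card_fun, Fintype.card_fin, ← hn, nsmul_eq_mul, nsmul_eq_mul]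
          have : (n : ℝ) - d = n * (1 - d / n) := by field_simp
          rw [this, mul_pow]
          push_cast
          ring
  obtain ⟨f, -, hf⟩ := Finset.exists_le_of_sum_le Finset.univ_nonempty hsum
  have hcard : (Finset.univ.image f).card ≤ k := by
    simpa using Finset.card_image_le (s := (Finset.univ : Finset (Fin k))) (f := f)
  obtain ⟨W, hW, hWk⟩ := Finset.exists_superset_card_eq hcard hk
  exact ⟨W, hWk, le_trans (Nat.cast_le.2 (Finset.card_le_card (unseparated_anti G S hW))) hf⟩

open Classical in
/-- Sparse case: neighbourhoods are so small that the number of possible positions shrinks in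
every round. -/
theorem copWins_of_nbhd_small [Nonempty V] (mayStay : Prop) (G : SimpleGraph V) (k : ℕ)
    (hk : k ≤ Fintype.card V) (d : ℝ) (hdn : d ≤ Fintype.card V)
    (hd : ∀ x y, x ≠ y → d ≤ ((separators G x y).card : ℝ)) (D : ℝ)
    (hD : ∀ v, ((Finset.univ.filter fun w => w = v ∨ G.Adj v w).card : ℝ) ≤ D)
    (hsmall : D ^ 2 * (1 - d / Fintype.card V) ^ k < 1 / 2) : CopWins mayStay G k := by
  have hq : 0 ≤ 1 - d / Fintype.card V := by
    rw [sub_nonneg]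
    exact div_le_one_of_le₀ hdn (Nat.cast_nonneg _)
  refine copWins_of_decreasing mayStay G k hk fun C hC => ?_
  obtain ⟨W, hWk, hW⟩ := exists_card_unseparated_le G (closedNbhd G C) k hk d hdn hd
  refine ⟨W, hWk, fun a => ?_⟩
  by_contra! hcon
  set T := (closedNbhd G C).filter fun v => signature G W v = a with hT
  have h1 : T.card * (T.card - 1) ≤ (unseparated G (closedNbhd G C) W).card :=
    card_mul_pred_le_card_unseparated G (Finset.filter_subset _ _) fun x hx y hy =>
      adj_iff_of_signature_eq
        ((Finset.mem_filter.1 hx).2.trans (Finset.mem_filter.1 hy).2.symm)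
  have hS : ((closedNbhd G C).card : ℝ) ≤ C.card * D := by
    have : closedNbhd G C = C.biUnion fun v => Finset.univ.filter fun w => w = v ∨ G.Adj v w := by
      ext w
      simp [closedNbhd]
    rw [this]
    refine (Nat.cast_le.2 Finset.card_biUnion_le).trans ?_
    rw [Nat.cast_sum, ← nsmul_eq_mul]
    exact Finset.sum_le_card_nsmul _ _ _ fun v _ => hD v
  have h2 : ((C.card * (C.card - 1) : ℕ) : ℝ) ≤ (unseparated G (closedNbhd G C) W).card := by
    refine Nat.cast_le.2 (le_trans ?_ h1)
    gcongr
  rw [Nat.cast_mul, Nat.cast_sub (by omega), Nat.cast_one] at h2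
  have hC' : (2 : ℝ) ≤ C.card := by exact_mod_cast hC
  have h3 : ((closedNbhd G C).card : ℝ) ^ 2 * (1 - d / Fintype.card V) ^ k
      ≤ (C.card : ℝ) ^ 2 * (D ^ 2 * (1 - d / Fintype.card V) ^ k) := by
    rw [← mul_assoc, ← mul_pow]
    gcongr
  have h4 : (C.card : ℝ) ^ 2 * (D ^ 2 * (1 - d / Fintype.card V) ^ k)
      < (C.card : ℝ) ^ 2 * (1 / 2) := by
    have : (0 : ℝ) < C.card := by linarith
    gcongr
  nlinarith

/-- Dense case: after a random test set the few vertices that are not yet determined are separated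
by `j` further vertices that are chosen with prescribed adjacencies. -/
theorem copWins_of_extension [Nonempty V] (mayStay : Prop) (G : SimpleGraph V) (k j Q : ℕ)
    (hk : k + j ≤ Fintype.card V) (d : ℝ) (hdn : d ≤ Fintype.card V)
    (hd : ∀ x y, x ≠ y → d ≤ ((separators G x y).card : ℝ))
    (hQ : (Fintype.card V : ℝ) ^ 2 * (1 - d / Fintype.card V) ^ k ≤ Q) (hQj : Q ≤ (2 ^ j) ^ 2)
    (hext : ∀ B A : Finset V, B.card ≤ Q → ∃ w, ∀ x ∈ B, G.Adj x w ↔ x ∈ A) :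
    CopWins mayStay G (k + j) := by
  classical
  obtain ⟨W, hWk, hW⟩ := exists_card_unseparated_le G Finset.univ k (by omega) d hdn hd
  have hWQ : (unseparated G Finset.univ W).card ≤ Q := by
    rw [Finset.card_univ] at hW
    exact_mod_cast hW.trans hQ
  set B := (unseparated G Finset.univ W).image Prod.fst with hB
  have hBQ : B.card ≤ Q := Finset.card_image_le.trans hWQ
  let trace : V → Finset V := fun x => W.filter fun w => G.Adj x w
  have htrace : ∀ x y, trace x = trace y ↔ ∀ w ∈ W, G.Adj x w ↔ G.Adj y w := by
    intro x y
    simp only [trace, Finset.filter_inj']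
  -- The classes are so small that `j` bits can tell their elements apart.
  have hlab : ∀ A : Finset V, ∃ g : V → Fin j → Bool,
      ∀ x y, trace x = A → trace y = A → g x = g y → x = y := by
    intro A
    set T := Finset.univ.filter fun x => trace x = A with hT
    have h1 : T.card * (T.card - 1) ≤ Q := by
      refine le_trans (card_mul_pred_le_card_unseparated G (Finset.subset_univ T) ?_) hWQ
      intro x hx y hy
      exact (htrace x y).1 ((Finset.mem_filter.1 hx).2.trans (Finset.mem_filter.1 hy).2.symm)
    have h2 : T.card ≤ 2 ^ j := by
      by_contra! hlt
      have h3 : (2 ^ j + 1) * 2 ^ j ≤ T.card * (T.card - 1) :=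
        Nat.mul_le_mul hlt (by omega)
      have h4 : 0 < 2 ^ j := by positivity
      nlinarith
    obtain ⟨f⟩ := Function.Embedding.nonempty_of_card_le
      (show Fintype.card T ≤ Fintype.card (Fin j → Bool) by simpa using h2)
    refine ⟨fun x => if h : x ∈ T then f ⟨x, h⟩ else default, fun x y hx hy hxy => ?_⟩
    have hx' : x ∈ T := by simpa [hT] using hx
    have hy' : y ∈ T := by simpa [hT] using hy
    simp only [dif_pos hx', dif_pos hy'] at hxy
    exact congrArg Subtype.val (f.injective hxy)
  choose g hg using hlab
  choose w hw using fun i : Fin j => hext B (Finset.univ.filter fun x => g (trace x) x i = true) hBQ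
  have hcard : (W ∪ Finset.univ.image w).card ≤ k + j := by
    refine (Finset.card_union_le _ _).trans ?_
    rw [hWk]
    have := Finset.card_image_le (s := (Finset.univ : Finset (Fin j))) (f := w)
    rw [Finset.card_univ, Fintype.card_fin] at this
    omega
  obtain ⟨W', hWW', hW'k⟩ := Finset.exists_superset_card_eq hcard hk
  refine copWins_of_decreasing mayStay G (k + j) hk fun C hC => ⟨W', hW'k, fun a => ?_⟩
  refine lt_of_le_of_lt (Finset.card_le_one.2 fun x hx y hy => ?_) (show 1 < C.card by omega)
  have hadj := adj_iff_of_signature_eq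
    ((Finset.mem_filter.1 hx).2.trans (Finset.mem_filter.1 hy).2.symm)
  have hadjW : ∀ w ∈ W, G.Adj x w ↔ G.Adj y w := fun w hw =>
    hadj w (hWW' (Finset.mem_union_left _ hw))
  by_contra hne
  have hxB : x ∈ B := Finset.mem_image.2 ⟨(x, y), mem_unseparated.2 ⟨by simp, hne, hadjW⟩, rfl⟩
  have hyB : y ∈ B := Finset.mem_image.2 ⟨(y, x), mem_unseparated.2
    ⟨by simp, Ne.symm hne, fun w hw => (hadjW w hw).symm⟩, rfl⟩
  have htr := (htrace x y).2 hadjW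
  refine hne (hg (trace y) x y htr rfl (funext fun i => ?_))
  have h1 := hw i x hxB
  have h2 := hw i y hyB
  have h3 := hadj (w i) (hWW' (Finset.mem_union_right _
    (Finset.mem_image_of_mem w (Finset.mem_univ i))))
  rw [h1, h2] at h3
  simp only [Finset.mem_filter, Finset.mem_univ, true_and, htr] at h3
  exact Bool.eq_iff_iff.2 h3

end Separation

/-! ### The robber in a graph of diameter two -/

section Robber

variable {V : Type*}

/-- In a graph of diameter at most two, neighbours with equal adjacencies to the test set have equal
distances to it. -/
theorem signature_eq_of_adj_iff (G : SimpleGraph V)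
    (hdiam : ∀ x y, x ≠ y → ∃ w, G.Adj w x ∧ G.Adj w y) {W : Finset V} {x y : V} (hx : x ∉ W)
    (hy : y ∉ W) (h : ∀ w ∈ W, G.Adj x w ↔ G.Adj y w) : signature G W x = signature G W y := by
  have key : ∀ z w, z ≠ w → ¬ G.Adj z w → G.edist z w = 2 := by
    intro z w hzw hadj
    obtain ⟨u, hu1, hu2⟩ := hdiam z w hzw
    refine le_antisymm ?_ ?_
    · exact SimpleGraph.edist_le (.cons hu1.symm (.cons hu2 .nil))
    · have h1 : 1 ≤ G.edist z w := by
        rw [Order.one_le_iff_pos, pos_iff_ne_zero]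
        exact fun h0 => hzw (SimpleGraph.edist_eq_zero_iff.1 h0)
      have h2 : G.edist z w ≠ 1 := fun h => hadj (SimpleGraph.edist_eq_one_iff_adj.1 h)
      have h3 : (1 : ℕ∞) < G.edist z w := lt_of_le_of_ne h1 h2.symm
      have := Order.add_one_le_of_lt h3
      rwa [one_add_one_eq_two] at this
  funext ⟨w, hw⟩
  simp only [signature]
  by_cases hxw : G.Adj x w
  · rw [SimpleGraph.edist_eq_one_iff_adj.2 hxw,
      SimpleGraph.edist_eq_one_iff_adj.2 ((h w hw).1 hxw)]
  · rw [key x w (fun e => hx (e ▸ hw)) hxw,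
      key y w (fun e => hy (e ▸ hw)) (fun h' => hxw ((h w hw).2 h'))]

theorem lt_localizationNumber_of_twins [Fintype V] [Nonempty V] (mayStay : Prop)
    (G : SimpleGraph V) (k : ℕ) (hk : k ≤ Fintype.card V)
    (hdiam : ∀ x y, x ≠ y → ∃ w, G.Adj w x ∧ G.Adj w y)
    (htwin : ∀ v, ∀ W : Finset V, W.card = k → ∃ x y, x ≠ y ∧ x ∉ W ∧ y ∉ W ∧ G.Adj v x ∧
      G.Adj v y ∧ ∀ w ∈ W, G.Adj x w ↔ G.Adj y w) :
    k < localizationNumber mayStay G := by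
  refine lt_localizationNumber mayStay G k fun j hj => not_copWins_of_confusable mayStay G j ?_
  intro v W hW
  obtain ⟨W', hWW', hW'⟩ := Finset.exists_superset_card_eq (hW.trans_le hj) hk
  obtain ⟨x, y, hxy, hx, hy, hvx, hvy, hadj⟩ := htwin v W' hW'
  exact ⟨x, y, hxy, hvx, hvy, signature_eq_of_adj_iff G hdiam (fun h => hx (hWW' h))
    (fun h => hy (hWW' h)) fun w hw => hadj w (hWW' hw)⟩

end Robber

/-! ### Union bounds -/

section UnionBounds

open MeasureTheory

variable {n : ℕ} (p : unitInterval)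

/-- The union bound with a uniform estimate. -/
theorem measureReal_exists_le {V ι : Type*} [Fintype V] (p : unitInterval) (s : Finset ι)
    (E : ι → Set (SimpleGraph V)) (c : ℝ)
    (hE : ∀ i ∈ s, (SimpleGraph.binomialRandom V p).real (E i) ≤ c) :
    (SimpleGraph.binomialRandom V p).real {G | ∃ i ∈ s, G ∈ E i} ≤ s.card * c := by
  have h : {G | ∃ i ∈ s, G ∈ E i} = ⋃ i ∈ s, E i := by
    ext G; simp
  rw [h]
  refine (measureReal_biUnion_finset_le s E).trans ?_
  rw [← nsmul_eq_mul]
  exact Finset.sum_le_card_nsmul _ _ _ hE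

theorem one_sub_pow_le_exp {x : ℝ} (hx : x ≤ 1) (m : ℕ) : (1 - x) ^ m ≤ Real.exp (-(m * x)) := by
  rw [← mul_neg, Real.exp_nat_mul]
  exact pow_le_pow_left₀ (by linarith) (by linarith [Real.add_one_le_exp (-x)]) m

theorem measureReal_not_diam_two_le (hn : 2 ≤ n) :
    (SimpleGraph.binomialRandom (Fin n) p).real
        {G | ¬ ∀ x y, x ≠ y → ∃ w, G.Adj w x ∧ G.Adj w y}
      ≤ n ^ 2 * Real.exp (2 - n * (p : ℝ) ^ 2) := by
  have hp1 : (p : ℝ) ^ 2 ≤ 1 := pow_le_one₀ p.2.1 p.2.2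
  have hs : {G : SimpleGraph (Fin n) | ¬ ∀ x y, x ≠ y → ∃ w, G.Adj w x ∧ G.Adj w y}
      ⊆ {G | ∃ e ∈ (Finset.univ : Finset (Fin n)).offDiag,
        G ∈ {G : SimpleGraph (Fin n) | ∀ w, ¬ (G.Adj w e.1 ∧ G.Adj w e.2)}} := by
    intro G hG
    simp only [Set.mem_ofPred_eq] at hG ⊢
    push Not at hG
    obtain ⟨x, y, hxy, h⟩ := hG
    exact ⟨(x, y), by simpa using hxy, fun w hw => h w hw.1 hw.2⟩
  refine (measureReal_mono hs).trans ((measureReal_exists_le p _ _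
    (Real.exp (2 - n * (p : ℝ) ^ 2)) fun e he => ?_).trans ?_)
  · refine (measureReal_no_common_neighbor_le p (Finset.mem_offDiag.1 he).2.2).trans ?_
    refine (one_sub_pow_le_exp hp1 _).trans (Real.exp_le_exp.2 ?_)
    rw [Fintype.card_fin, Nat.cast_sub hn]
    push_cast
    linarith
  · refine mul_le_mul_of_nonneg_right ?_ (Real.exp_pos _).le
    rw [Finset.offDiag_card, Finset.card_univ, Fintype.card_fin]
    exact_mod_cast (Nat.sub_le _ _).trans (sq n).ge

theorem measureReal_few_separators_le (hn : 2 ≤ n) (δ : ℝ) (h0 : 0 ≤ δ) (h1 : δ ≤ 1) :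
    (SimpleGraph.binomialRandom (Fin n) p).real
        {G | ¬ ∀ x y, x ≠ y → (1 - δ) * (2 * p * (1 - p)) * n ≤ ((separators G x y).card : ℝ)}
      ≤ n ^ 2 * Real.exp (1 - δ ^ 2 * (2 * p * (1 - p)) * n / 2) := by
  set a : ℝ := 2 * p * (1 - p) with ha
  have ha0 : 0 ≤ a := mul_nonneg (mul_nonneg two_pos.le p.2.1) (sub_nonneg.2 p.2.2)
  have ha1 : a ≤ 1 / 2 := by nlinarith [sq_nonneg (2 * (p : ℝ) - 1)]
  have hs : {G : SimpleGraph (Fin n) | ¬ ∀ x y, x ≠ y →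
        (1 - δ) * a * n ≤ ((separators G x y).card : ℝ)}
      ⊆ {G | ∃ e ∈ (Finset.univ : Finset (Fin n)).offDiag,
        G ∈ {G : SimpleGraph (Fin n) | ((separators G e.1 e.2).card : ℝ) ≤ (1 - δ) * a * n}} := by
    intro G hG
    simp only [Set.mem_ofPred_eq] at hG ⊢
    push Not at hG
    obtain ⟨x, y, hxy, h⟩ := hG
    exact ⟨(x, y), by simpa using hxy, h.le⟩
  refine (measureReal_mono hs).trans ((measureReal_exists_le p _ _
    (Real.exp (1 - δ ^ 2 * a * n / 2)) fun e he => ?_).trans ?_)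
  · refine (measureReal_card_separators_le p (Finset.mem_offDiag.1 he).2.2 _ δ h0).trans ?_
    have hx0 : 0 ≤ 1 - Real.exp (-δ) := by
      rw [sub_nonneg, Real.exp_le_one_iff]; linarith
    have hx1 : 1 - Real.exp (-δ) ≤ δ := by linarith [Real.add_one_le_exp (-δ)]
    have hx2 : δ - δ ^ 2 / 2 ≤ 1 - Real.exp (-δ) := by
      have hq := Real.quadratic_le_exp_of_nonneg h0
      have hprod : Real.exp (-δ) * Real.exp δ = 1 := by rw [← Real.exp_add]; simp
      have hpos := Real.exp_pos (-δ)
      have h2 : Real.exp (-δ) * (1 + δ + δ ^ 2 / 2) ≤ 1 :=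
        (mul_le_mul_of_nonneg_left hq hpos.le).trans hprod.le
      have h3 : (1 : ℝ) ≤ (1 - δ + δ ^ 2 / 2) * (1 + δ + δ ^ 2 / 2) := by
        nlinarith [sq_nonneg (δ ^ 2)]
      have h4 : Real.exp (-δ) ≤ 1 - δ + δ ^ 2 / 2 :=
        le_of_mul_le_mul_right (h2.trans h3) (by positivity)
      linarith
    calc _ ≤ Real.exp (δ * ((1 - δ) * a * n)) *
          Real.exp (-(((n - 2 : ℕ) : ℝ) * (a * (1 - Real.exp (-δ))))) := by
          rw [Fintype.card_fin]
          refine mul_le_mul_of_nonneg_left (one_sub_pow_le_exp ?_ _) (Real.exp_pos _).le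
          nlinarith
      _ ≤ _ := by
          rw [← Real.exp_add, Nat.cast_sub hn]
          apply Real.exp_le_exp.2
          push_cast
          have e1 : a * n * (δ - δ ^ 2 / 2) ≤ a * n * (1 - Real.exp (-δ)) :=
            mul_le_mul_of_nonneg_left hx2 (by positivity)
          have e2 : a * (1 - Real.exp (-δ)) ≤ 1 / 2 * 1 :=
            mul_le_mul ha1 (hx1.trans h1) hx0 (by norm_num)
          nlinarith
  · refine mul_le_mul_of_nonneg_right ?_ (Real.exp_pos _).le
    rw [Finset.offDiag_card, Finset.card_univ, Fintype.card_fin]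
    exact_mod_cast (Nat.sub_le _ _).trans (sq n).ge

open Classical in
theorem measureReal_large_degree_le :
    (SimpleGraph.binomialRandom (Fin n) p).real
        {G | ¬ ∀ x, ((Finset.univ.filter fun w => G.Adj x w).card : ℝ) ≤ 3 * ((n : ℝ) * p)}
      ≤ n * Real.exp (-((n : ℝ) * p)) := by
  have hs : {G : SimpleGraph (Fin n) | ¬ ∀ x,
        ((Finset.univ.filter fun w => G.Adj x w).card : ℝ) ≤ 3 * ((n : ℝ) * p)}
      ⊆ {G | ∃ x ∈ (Finset.univ : Finset (Fin n)), G ∈ {G : SimpleGraph (Fin n) |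
        3 * ((n : ℝ) * p) ≤ ((Finset.univ.filter fun w => G.Adj x w).card : ℝ)}} := by
    intro G hG
    simp only [Set.mem_ofPred_eq] at hG ⊢
    push Not at hG
    obtain ⟨x, h⟩ := hG
    exact ⟨x, Finset.mem_univ _, h.le⟩
  refine (measureReal_mono hs).trans ((measureReal_exists_le p _ _
    (Real.exp (-((n : ℝ) * p))) fun x _ => ?_).trans (by simp))
  refine (measureReal_le_degree p x _).trans (Real.exp_le_exp.2 ?_)
  rw [Fintype.card_fin]
  linarith

/-- The extension property for all sets of at most `Q` vertices, with a union bound over functions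
from `Fin Q` to the vertices and subsets of `Fin Q`. -/
theorem measureReal_not_extension_le (Q : ℕ) (hQ : Q ≤ n) (hn : 0 < n) (μ : ℝ)
    (hμ : 0 ≤ μ) (hμp : μ ≤ p) (hμq : μ ≤ 1 - p) :
    (SimpleGraph.binomialRandom (Fin n) p).real
        {G | ¬ ∀ B A : Finset (Fin n), B.card ≤ Q → ∃ w, ∀ x ∈ B, G.Adj x w ↔ x ∈ A}
      ≤ (2 * n : ℝ) ^ Q * Real.exp (-((n - Q) * μ ^ Q)) := by
  have hμ1 : μ ≤ 1 := hμp.trans p.2.2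
  have : NeZero n := ⟨hn.ne'⟩
  have hs : {G : SimpleGraph (Fin n) | ¬ ∀ B A : Finset (Fin n), B.card ≤ Q →
        ∃ w, ∀ x ∈ B, G.Adj x w ↔ x ∈ A}
      ⊆ {G | ∃ e ∈ (Finset.univ : Finset ((Fin Q → Fin n) × Finset (Fin Q))),
        G ∈ {G : SimpleGraph (Fin n) | ¬ ∃ w, ∀ x ∈ Finset.univ.image e.1,
          G.Adj x w ↔ x ∈ e.2.image e.1}} := by
    intro G hG
    simp only [Set.mem_ofPred_eq] at hG ⊢
    push Not at hG
    obtain ⟨B, A, hB, h⟩ := hG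
    -- `B` is covered by the range of a function on `Fin Q`.
    obtain ⟨f, hf⟩ : ∃ f : Fin Q → Fin n, ∀ x ∈ B, ∃ i, f i = x := by
      obtain ⟨g⟩ := Function.Embedding.nonempty_of_card_le
        (show Fintype.card B ≤ Fintype.card (Fin Q) by simpa using hB)
      refine ⟨fun i => if h : ∃ x : B, g x = i then h.choose.1 else 0, fun x hx => ⟨g ⟨x, hx⟩, ?_⟩⟩
      have hex : ∃ y : B, g y = g ⟨x, hx⟩ := ⟨_, rfl⟩
      simp only [dif_pos hex]
      exact congrArg Subtype.val (g.injective hex.choose_spec)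
    refine ⟨(f, Finset.univ.filter fun i => f i ∈ A), Finset.mem_univ _, ?_⟩
    rintro ⟨w, hw⟩
    obtain ⟨x, hxB, hx⟩ := h w
    obtain ⟨i, rfl⟩ := hf x hxB
    have h1 := hw (f i) (Finset.mem_image_of_mem f (Finset.mem_univ i))
    have h2 : f i ∈ (Finset.univ.filter fun i => f i ∈ A).image f ↔ f i ∈ A := by
      simp only [Finset.mem_image, Finset.mem_filter, Finset.mem_univ, true_and]
      constructor
      · rintro ⟨j, hj, hji⟩
        exact hji ▸ hj
      · intro hi
        exact ⟨i, hi, rfl⟩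
    rw [h2] at h1
    rcases hx with hx | hx <;> tauto
  refine (measureReal_mono hs).trans ((measureReal_exists_le p _ _
    (Real.exp (-((n - Q) * μ ^ Q))) fun e _ => ?_).trans (le_of_eq ?_))
  · refine (measureReal_no_extension_le p _ _ μ hμ hμp hμq).trans ?_
    set B := Finset.univ.image e.1
    have hB : B.card ≤ Q := by
      simpa using Finset.card_image_le (s := (Finset.univ : Finset (Fin Q))) (f := e.1)
    refine (one_sub_pow_le_exp (pow_le_one₀ hμ hμ1) _).trans (Real.exp_le_exp.2 ?_)
    rw [neg_le_neg_iff, Fintype.card_fin, Nat.cast_sub (hB.trans hQ)]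
    have hB' : (B.card : ℝ) ≤ Q := by exact_mod_cast hB
    have hQ' : (Q : ℝ) ≤ n := by exact_mod_cast hQ
    exact mul_le_mul (by linarith) (pow_le_pow_of_le_one hμ hμ1 hB) (by positivity) (by linarith)
  · simp [mul_pow, mul_comm]

theorem measureReal_not_twins_le (k m : ℕ) (r : ℝ)
    (hr2 : r ^ 2 ≤ (p : ℝ) ^ 2 * ((p : ℝ) ^ 2 + (1 - p) ^ 2) ^ k)
    (hm : 1 ≤ m * r) (hcard : 2 * m + k + 1 ≤ n) :
    (SimpleGraph.binomialRandom (Fin n) p).real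
        {G | ¬ ∀ v, ∀ W : Finset (Fin n), W.card = k → ∃ x y, x ≠ y ∧ x ∉ W ∧ y ∉ W ∧ G.Adj v x ∧
          G.Adj v y ∧ ∀ w ∈ W, G.Adj x w ↔ G.Adj y w}
      ≤ (n : ℝ) ^ (k + 1) * Real.exp (-(m * r / 2)) := by
  have hs : {G : SimpleGraph (Fin n) | ¬ ∀ v, ∀ W : Finset (Fin n), W.card = k →
        ∃ x y, x ≠ y ∧ x ∉ W ∧ y ∉ W ∧ G.Adj v x ∧ G.Adj v y ∧ ∀ w ∈ W, G.Adj x w ↔ G.Adj y w}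
      ⊆ {G | ∃ e ∈ (Finset.univ : Finset (Fin n)) ×ˢ Finset.powersetCard k Finset.univ,
        G ∈ {G : SimpleGraph (Fin n) | ¬ ∃ x y, x ≠ y ∧ x ∉ e.2 ∧ y ∉ e.2 ∧ G.Adj e.1 x ∧
          G.Adj e.1 y ∧ ∀ w ∈ e.2, G.Adj x w ↔ G.Adj y w}} := by
    intro G hG
    simp only [Set.mem_ofPred_eq] at hG ⊢
    rw [not_forall] at hG
    obtain ⟨v, hG⟩ := hG
    rw [not_forall] at hG
    obtain ⟨W, hG⟩ := hG
    rw [Classical.not_imp] at hG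
    exact ⟨(v, W), by simp [hG.1], hG.2⟩
  refine (measureReal_mono hs).trans ((measureReal_exists_le p _ _
    (Real.exp (-(m * r / 2))) fun e he => ?_).trans ?_)
  · have hk : e.2.card = k := (Finset.mem_powersetCard.1 (Finset.mem_product.1 he).2).2
    refine measureReal_no_twins_le p e.1 e.2 m r (by rw [hk]; exact hr2) hm ?_
    rw [hk, Fintype.card_fin]
    exact hcard
  · refine mul_le_mul_of_nonneg_right ?_ (Real.exp_pos _).le
    rw [Finset.card_product, Finset.card_powersetCard, Finset.card_univ, Fintype.card_fin,
      pow_succ']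
    exact_mod_cast Nat.mul_le_mul_left n (Nat.choose_le_pow n k)

end UnionBounds

/-! ### The two bounds in a fixed graph -/

section Numerics

variable {p L c : ℝ}

theorem log_one_div_rho_bounds (h0 : 0 < p) (h1 : p < 1) :
    0 < 2 * p * (1 - p) ∧ 2 * p * (1 - p) ≤ Real.log (1 / (p ^ 2 + (1 - p) ^ 2)) ∧
      Real.log (1 / (p ^ 2 + (1 - p) ^ 2)) ≤ Real.log 2 ∧
      Real.exp (-Real.log (1 / (p ^ 2 + (1 - p) ^ 2))) = p ^ 2 + (1 - p) ^ 2 := by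
  have ha : 0 < 2 * p * (1 - p) := mul_pos (by linarith) (by linarith)
  have hρ : p ^ 2 + (1 - p) ^ 2 = 1 - 2 * p * (1 - p) := by ring
  have hρ2 : 1 / 2 ≤ p ^ 2 + (1 - p) ^ 2 := by nlinarith [sq_nonneg (2 * p - 1)]
  have hρ0 : 0 < p ^ 2 + (1 - p) ^ 2 := by linarith
  refine ⟨ha, ?_, ?_, ?_⟩
  · rw [one_div, Real.log_inv]
    have := Real.log_le_sub_one_of_pos hρ0
    linarith
  · apply Real.log_le_log (by positivity)
    rw [div_le_iff₀ hρ0]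
    linarith
  · rw [one_div, Real.log_inv, neg_neg, Real.exp_log hρ0]

/-- The loss in the exponent when `ρ` is replaced by the empirical frequency, and when the number
of vertices is rounded and diminished by `j`, is only a constant factor. -/
theorem empirical_rho_pow_le (h0 : 0 < p) (h1 : p < 1) (hL : 8 ≤ L) (hc0 : 0 ≤ c) {k j : ℕ}
    (hY : 0 ≤ (1 - c * (Real.log (1 / p) / L)) *
      (2 * L / Real.log (1 / (p ^ 2 + (1 - p) ^ 2))))
    (hk : k + j = ⌊(1 - c * (Real.log (1 / p) / L)) *
      (2 * L / Real.log (1 / (p ^ 2 + (1 - p) ^ 2)))⌋₊) :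
    (1 - (1 - 1 / L ^ 2) * (2 * p * (1 - p))) ^ k
      ≤ 4 * 2 ^ j * (Real.exp (-(2 * L)) * p ^ (-(2 * c))) := by
  obtain ⟨ha, hal, hl2, hexp⟩ := log_one_div_rho_bounds h0 h1
  set a := 2 * p * (1 - p) with hadef
  set ℓ := Real.log (1 / (p ^ 2 + (1 - p) ^ 2)) with hℓ
  set Y := (1 - c * (Real.log (1 / p) / L)) * (2 * L / ℓ) with hYdef
  have hℓ0 : 0 < ℓ := lt_of_lt_of_le ha hal
  have hL0 : 0 < L := by linarith
  have hρ : p ^ 2 + (1 - p) ^ 2 = 1 - a := by rw [hadef]; ring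
  have ha2 : a ≤ 1 / 2 := by nlinarith [sq_nonneg (2 * p - 1)]
  have hlp : 0 ≤ Real.log (1 / p) := Real.log_nonneg (by rw [le_div_iff₀ h0]; linarith)
  have hkY : (k : ℝ) ≤ Y := by
    have h2 : ((k + j : ℕ) : ℝ) ≤ Y := hk ▸ Nat.floor_le hY
    push_cast at h2
    linarith [(Nat.cast_nonneg j : (0 : ℝ) ≤ j)]
  have hkY' : Y < k + j + 1 := by
    have := Nat.lt_floor_add_one Y
    rw [← hk] at this
    exact_mod_cast this
  have hYl : Y * ℓ = 2 * L - 2 * c * Real.log (1 / p) := by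
    rw [hYdef]
    field_simp
  have hkL : k * a ≤ 2 * L := by
    have h2 : (k : ℝ) * a ≤ Y * ℓ := mul_le_mul hkY hal ha.le hY
    have h3 : 0 ≤ 2 * c * Real.log (1 / p) := by positivity
    linarith
  have hbase : 1 - (1 - 1 / L ^ 2) * a ≤ Real.exp (-ℓ + 2 * a / L ^ 2) := by
    rw [Real.exp_add, hexp, hρ]
    have h2 : 1 + 2 * a / L ^ 2 ≤ Real.exp (2 * a / L ^ 2) := by
      linarith [Real.add_one_le_exp (2 * a / L ^ 2)]
    have h3 : 0 ≤ a / L ^ 2 := by positivity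
    calc _ = (1 - a) + a / L ^ 2 := by ring
      _ ≤ (1 - a) * (1 + 2 * a / L ^ 2) := by
          have h4 : 2 * a / L ^ 2 = 2 * (a / L ^ 2) := by ring
          rw [h4]
          nlinarith
      _ ≤ _ := mul_le_mul_of_nonneg_left h2 (by linarith)
  have hb0 : 0 ≤ 1 - (1 - 1 / L ^ 2) * a := by
    have h2 : 0 ≤ 1 / L ^ 2 * a := by positivity
    linarith
  have hpow : p ^ (-(2 * c)) = Real.exp (2 * c * Real.log (1 / p)) := by
    rw [Real.rpow_def_of_pos h0, one_div, Real.log_inv]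
    congr 1
    ring
  have hexp2 : Real.exp ℓ ≤ 2 := by
    rw [← Real.exp_log (two_pos : (0 : ℝ) < 2)]
    exact Real.exp_le_exp.2 hl2
  have hhalf : Real.exp (1 / 2) ≤ 2 := by
    have h3 := Real.add_one_le_exp (-(1 / 2 : ℝ))
    rw [Real.exp_neg] at h3
    rw [← inv_le_inv₀ two_pos (Real.exp_pos _)]
    linarith
  calc (1 - (1 - 1 / L ^ 2) * a) ^ k ≤ Real.exp (-ℓ + 2 * a / L ^ 2) ^ k :=
        pow_le_pow_left₀ hb0 hbase k
    _ = Real.exp (k * (-ℓ + 2 * a / L ^ 2)) := (Real.exp_nat_mul _ _).symm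
    _ ≤ Real.exp (-(2 * L) + 2 * c * Real.log (1 / p) + (j + 1 : ℕ) * ℓ + 1 / 2) := by
        apply Real.exp_le_exp.2
        have h2 : Y * ℓ ≤ (k + j + 1) * ℓ := by gcongr
        have h3 : k * (2 * a / L ^ 2) ≤ 1 / 2 := by
          have : (k : ℝ) * (2 * a / L ^ 2) = 2 * (k * a) / L ^ 2 := by ring
          rw [this, div_le_div_iff₀ (by positivity) two_pos]
          nlinarith
        push_cast
        nlinarith
    _ = Real.exp (1 / 2) * Real.exp ℓ ^ (j + 1) *
          (Real.exp (-(2 * L)) * Real.exp (2 * c * Real.log (1 / p))) := by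
        rw [← Real.exp_nat_mul, ← Real.exp_add, ← Real.exp_add, ← Real.exp_add]
        congr 1
        ring
    _ ≤ 2 * 2 ^ (j + 1) * (Real.exp (-(2 * L)) * Real.exp (2 * c * Real.log (1 / p))) := by
        gcongr
    _ = _ := by rw [hpow]; ring

end Numerics

section FixedGraph

variable {n : ℕ} {p c : ℝ}

/-- Bounds on `p` that hold in the range of the theorem. -/
structure InRange (n : ℕ) (p : ℝ) : Prop where
  log_ge : 24 ≤ Real.log n
  sqrt_ge : 4 * Real.log n ^ 6 ≤ √n
  le_p : 1 / √n ≤ p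
  le_q : 1 / Real.log n ≤ 1 - p

namespace InRange

theorem log_pos (h : InRange n p) : 0 < Real.log n := by linarith [h.log_ge]

theorem cast_pos (h : InRange n p) : (0 : ℝ) < n := by
  refine Nat.cast_pos.2 (Nat.pos_of_ne_zero fun hn => ?_)
  have := h.log_pos
  rw [hn, Nat.cast_zero, Real.log_zero] at this
  exact lt_irrefl _ this

theorem exp_log (h : InRange n p) : Real.exp (Real.log n) = n := Real.exp_log h.cast_pos

theorem le_sqrt (h : InRange n p) {i : ℕ} (hi : i ≤ 6) : 4 * Real.log n ^ i ≤ √n := by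
  have h1 : Real.log n ^ i ≤ Real.log n ^ 6 :=
    pow_le_pow_right₀ (by linarith [h.log_ge]) hi
  linarith [h.sqrt_ge]

theorem sqrt_pos (h : InRange n p) : 0 < √(n : ℝ) := Real.sqrt_pos.2 h.cast_pos

theorem p_pos (h : InRange n p) : 0 < p :=
  lt_of_lt_of_le (one_div_pos.2 h.sqrt_pos) h.le_p

theorem p_lt_one (h : InRange n p) : p < 1 := by
  have := one_div_pos.2 h.log_pos
  linarith [h.le_q]

theorem sqrt_le_mul (h : InRange n p) : √(n : ℝ) ≤ n * p := by
  have h1 := mul_le_mul_of_nonneg_left h.le_p h.cast_pos.le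
  rwa [mul_one_div, Real.div_sqrt] at h1

theorem log_one_div_p_nonneg (h : InRange n p) : 0 ≤ Real.log (1 / p) :=
  Real.log_nonneg (by rw [le_div_iff₀ h.p_pos]; linarith [h.p_lt_one])

theorem log_one_div_p_le (h : InRange n p) : Real.log (1 / p) ≤ Real.log n / 2 := by
  rw [← Real.log_sqrt h.cast_pos.le]
  refine Real.log_le_log (one_div_pos.2 h.p_pos) ?_
  rw [div_le_iff₀ h.p_pos]
  have := h.le_p
  rwa [div_le_iff₀ h.sqrt_pos, mul_comm] at this

/-- The scale `2 log n / log (1/ρ)` of the localization number is small compared to `n`. -/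
theorem scale_le (h : InRange n p) :
    2 * Real.log n / Real.log (1 / (p ^ 2 + (1 - p) ^ 2)) ≤ Real.log n / (p * (1 - p)) ∧
      Real.log n / (p * (1 - p)) ≤ Real.log n ^ 2 / p ∧ Real.log n ^ 2 / p ≤ n / 4 := by
  obtain ⟨ha, hal, -, -⟩ := log_one_div_rho_bounds h.p_pos h.p_lt_one
  have hp := h.p_pos
  have hq : 0 < 1 - p := by linarith [h.p_lt_one]
  have hL := h.log_pos
  refine ⟨?_, ?_, ?_⟩
  · rw [div_le_div_iff₀ (lt_of_lt_of_le ha hal) (mul_pos hp hq)]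
    nlinarith
  · rw [div_le_div_iff₀ (mul_pos hp hq) hp]
    have h1 : 1 ≤ (1 - p) * Real.log n := by
      have := h.le_q
      rwa [div_le_iff₀ hL] at this
    have h2 : 0 ≤ Real.log n * p := by positivity
    nlinarith
  · rw [div_le_div_iff₀ hp four_pos]
    have h1 := h.le_sqrt (i := 2) (by norm_num)
    linarith [h.sqrt_le_mul]

theorem rho_scale_nonneg (h : InRange n p) :
    0 ≤ 2 * Real.log n / Real.log (1 / (p ^ 2 + (1 - p) ^ 2)) := by
  obtain ⟨ha, hal, -, -⟩ := log_one_div_rho_bounds h.p_pos h.p_lt_one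
  exact div_nonneg (by linarith [h.log_pos]) (ha.le.trans hal)

/-- The upper bound of the theorem lies between `log n` and `n`. -/
theorem upper_bounds (h : InRange n p) (hc0 : 0 < c) (hc1 : c < 1) :
    Real.log n ≤ (1 - c * (Real.log (1 / p) / Real.log n)) *
        (2 * Real.log n / Real.log (1 / (p ^ 2 + (1 - p) ^ 2))) ∧
      (1 - c * (Real.log (1 / p) / Real.log n)) *
        (2 * Real.log n / Real.log (1 / (p ^ 2 + (1 - p) ^ 2))) ≤ n := by
  obtain ⟨ha, hal, hl2, -⟩ := log_one_div_rho_bounds h.p_pos h.p_lt_one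
  obtain ⟨hs1, hs2, hs3⟩ := h.scale_le
  have hs0 := h.rho_scale_nonneg
  have hL := h.log_pos
  have hη0 : 0 ≤ Real.log (1 / p) / Real.log n := div_nonneg h.log_one_div_p_nonneg hL.le
  have hη1 : Real.log (1 / p) / Real.log n ≤ 1 / 2 := by
    rw [div_le_iff₀ hL]
    linarith [h.log_one_div_p_le]
  generalize Real.log (1 / p) / Real.log n = η at hη0 hη1 ⊢
  set ℓ := Real.log (1 / (p ^ 2 + (1 - p) ^ 2))
  have hℓ0 : 0 < ℓ := ha.trans_le hal
  have hl1 : ℓ ≤ 1 := hl2.trans (by linarith [Real.log_two_lt_d9])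
  have hcη : c * η ≤ 1 * (1 / 2) := mul_le_mul hc1.le hη1 hη0 zero_le_one
  have hcη0 : 0 ≤ c * η := mul_nonneg hc0.le hη0
  constructor
  · calc Real.log n ≤ Real.log n / ℓ := by
          rw [le_div_iff₀ hℓ0]
          exact mul_le_of_le_one_right hL.le hl1
      _ = 1 / 2 * (2 * Real.log n / ℓ) := by ring
      _ ≤ _ := mul_le_mul_of_nonneg_right (by linarith) hs0
  · refine (mul_le_of_le_one_left hs0 (by linarith)).trans ?_
    linarith [h.cast_pos]

/-- A random test set of `k` vertices leaves at most this many ordered pairs unseparated on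
average, where `j` is the number of vertices of the test set that are kept back. -/
theorem sq_mul_empirical_pow_le (h : InRange n p) (hc0 : 0 < c) (hc1 : c < 1) {k j : ℕ}
    (hk : k + j = ⌊(1 - c * (Real.log (1 / p) / Real.log n)) *
      (2 * Real.log n / Real.log (1 / (p ^ 2 + (1 - p) ^ 2)))⌋₊) :
    (n : ℝ) ^ 2 * (1 - (1 - 1 / Real.log n ^ 2) * (2 * p * (1 - p))) ^ k
      ≤ 4 * 2 ^ j * p ^ (-(2 * c)) := by
  have hn := h.cast_pos
  have h1 := empirical_rho_pow_le h.p_pos h.p_lt_one (by linarith [h.log_ge]) hc0.le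
    (h.log_pos.le.trans (h.upper_bounds hc0 hc1).1) hk
  have hexpn : Real.exp (-(2 * Real.log n)) = 1 / (n : ℝ) ^ 2 := by
    rw [Real.exp_neg, two_mul, Real.exp_add, h.exp_log, one_div, sq]
  rw [hexpn] at h1
  refine (mul_le_mul_of_nonneg_left h1 (sq_nonneg (n : ℝ))).trans (le_of_eq ?_)
  generalize p ^ (-(2 * c)) = t
  field_simp

end InRange

/-- The number of separators that the concentration bound guarantees, as a fraction of `n`. -/
theorem separator_density (h : InRange n p) :
    (1 - 1 / Real.log n ^ 2) * (2 * p * (1 - p)) * n ≤ Fintype.card (Fin n) ∧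
      (1 - 1 / Real.log n ^ 2) * (2 * p * (1 - p)) * n / Fintype.card (Fin n)
        = (1 - 1 / Real.log n ^ 2) * (2 * p * (1 - p)) := by
  have hn := h.cast_pos
  obtain ⟨ha, -, -, -⟩ := log_one_div_rho_bounds h.p_pos h.p_lt_one
  have ha2 : 2 * p * (1 - p) ≤ 1 := by nlinarith [sq_nonneg (2 * p - 1)]
  rw [Fintype.card_fin]
  constructor
  · have hδ0 : 0 ≤ 1 / Real.log n ^ 2 := by positivity
    generalize 1 / Real.log n ^ 2 = δ at hδ0
    generalize 2 * p * (1 - p) = a at ha ha2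
    exact mul_le_of_le_one_left hn.le (by nlinarith)
  · exact mul_div_cancel_right₀ _ hn.ne'

/-- The case `p ≥ ε`: `j` vertices of the test set are reserved for the extension property. -/
theorem copWins_dense (h : InRange n p) (mayStay : Prop) (G : SimpleGraph (Fin n))
    (hc0 : 0 < c) (hc1 : c < 1) {ε : ℝ} (hε0 : 0 < ε) {j : ℕ}
    (hj : 4 / ε ^ 2 ≤ 2 ^ j) (hjL : j + 1 ≤ Real.log n)
    (hsep : ∀ x y, x ≠ y → (1 - 1 / Real.log n ^ 2) * (2 * p * (1 - p)) * n
      ≤ ((separators G x y).card : ℝ)) (hεp : ε ≤ p)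
    (hext : ∀ B A : Finset (Fin n), B.card ≤ (2 ^ j) ^ 2 →
      ∃ w, ∀ x ∈ B, G.Adj x w ↔ x ∈ A) :
    CopWins mayStay G ⌊(1 - c * (Real.log (1 / p) / Real.log n)) *
      (2 * Real.log n / Real.log (1 / (p ^ 2 + (1 - p) ^ 2)))⌋₊ := by
  have hp := h.p_pos
  obtain ⟨hY1, hY2⟩ := h.upper_bounds hc0 hc1
  have hnum := fun k => h.sq_mul_empirical_pow_le hc0 hc1 (k := k) (j := j)
  obtain ⟨hdn, hdiv⟩ := separator_density h
  have : Nonempty (Fin n) := ⟨⟨0, by exact_mod_cast h.cast_pos⟩⟩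
  set Y := (1 - c * (Real.log (1 / p) / Real.log n)) *
      (2 * Real.log n / Real.log (1 / (p ^ 2 + (1 - p) ^ 2)))
  have hfln : ⌊Y⌋₊ ≤ n := Nat.floor_le_of_le hY2
  have hjY : j ≤ ⌊Y⌋₊ := Nat.le_floor (by linarith)
  have hk : (⌊Y⌋₊ - j) + j = ⌊Y⌋₊ := Nat.sub_add_cancel hjY
  rw [← hk]
  refine copWins_of_extension mayStay G (⌊Y⌋₊ - j) j ((2 ^ j) ^ 2)
    (by rw [Fintype.card_fin]; omega) _ hdn hsep ?_ le_rfl hext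
  rw [hdiv, Fintype.card_fin]
  have h2 : p ^ (-(2 * c)) ≤ 1 / ε ^ 2 := by
    rw [Real.rpow_neg hp.le, ← one_div]
    refine one_div_le_one_div_of_le (by positivity) ?_
    calc ε ^ 2 ≤ p ^ 2 := pow_le_pow_left₀ hε0.le hεp 2
      _ = p ^ (2 : ℝ) := by norm_cast
      _ ≤ p ^ (2 * c) := Real.rpow_le_rpow_of_exponent_ge hp h.p_lt_one.le (by linarith)
  refine (hnum _ hk).trans ?_
  calc _ ≤ 4 * 2 ^ j * (1 / ε ^ 2) := mul_le_mul_of_nonneg_left h2 (by positivity)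
    _ = 4 / ε ^ 2 * 2 ^ j := by ring
    _ ≤ 2 ^ j * 2 ^ j := mul_le_mul_of_nonneg_right hj (by positivity)
    _ = _ := by push_cast; ring

open Classical in
/-- The case `p ≤ ε`: closed neighbourhoods have at most `4np` elements. -/
theorem copWins_sparse (h : InRange n p) (mayStay : Prop) (G : SimpleGraph (Fin n))
    (hc0 : 0 < c) (hc1 : c < 1) {ε : ℝ} (hε : ε ^ (2 - 2 * c) ≤ 1 / 256)
    (hsep : ∀ x y, x ≠ y → (1 - 1 / Real.log n ^ 2) * (2 * p * (1 - p)) * n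
      ≤ ((separators G x y).card : ℝ)) (hεp : p ≤ ε)
    (hdeg : ∀ x, ((Finset.univ.filter fun w => G.Adj x w).card : ℝ) ≤ 3 * (n * p)) :
    CopWins mayStay G ⌊(1 - c * (Real.log (1 / p) / Real.log n)) *
      (2 * Real.log n / Real.log (1 / (p ^ 2 + (1 - p) ^ 2)))⌋₊ := by
  have hp := h.p_pos
  obtain ⟨hY1, hY2⟩ := h.upper_bounds hc0 hc1
  have hnum := h.sq_mul_empirical_pow_le hc0 hc1 (j := 0) rfl
  obtain ⟨hdn, hdiv⟩ := separator_density h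
  have : Nonempty (Fin n) := ⟨⟨0, by exact_mod_cast h.cast_pos⟩⟩
  refine copWins_of_nbhd_small mayStay G _
    (by rw [Fintype.card_fin]; exact Nat.floor_le_of_le hY2) _ hdn hsep
    (4 * (n * p)) (fun v => ?_) ?_
  · refine (Nat.cast_le.2 (Finset.card_le_card
      (t := insert v (Finset.univ.filter fun w => G.Adj v w)) fun w hw => ?_)).trans ?_
    · simpa using hw
    have h2 : ((insert v (Finset.univ.filter fun w => G.Adj v w)).card : ℝ)
        ≤ (Finset.univ.filter fun w => G.Adj v w).card + 1 := by
      exact_mod_cast Finset.card_insert_le _ _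
    have h3 : 1 ≤ n * p := by
      have := h.le_sqrt (i := 0) (by norm_num)
      rw [pow_zero] at this
      linarith [h.sqrt_le_mul]
    linarith [hdeg v]
  · rw [hdiv]
    have h2 : p ^ (2 - 2 * c) ≤ 1 / 256 :=
      (Real.rpow_le_rpow hp.le hεp (by linarith)).trans hε
    have h3 : p ^ 2 * p ^ (-(2 * c)) = p ^ (2 - 2 * c) := by
      rw [← Real.rpow_natCast, ← Real.rpow_add hp]
      norm_num
      ring_nf
    rw [pow_zero, mul_one] at hnum
    have key : ∀ t : ℝ, (n : ℝ) ^ 2 * t ≤ 4 * p ^ (-(2 * c)) → (4 * (n * p)) ^ 2 * t < 1 / 2 := by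
      intro t ht
      calc (4 * (n * p)) ^ 2 * t = 16 * p ^ 2 * ((n : ℝ) ^ 2 * t) := by ring
        _ ≤ 16 * p ^ 2 * (4 * p ^ (-(2 * c))) := mul_le_mul_of_nonneg_left ht (by positivity)
        _ = 64 * (p ^ 2 * p ^ (-(2 * c))) := by ring
        _ ≤ 64 * (1 / 256) := by
            rw [h3]
            exact mul_le_mul_of_nonneg_left h2 (by norm_num)
        _ < 1 / 2 := by norm_num
    exact key _ hnum

open Classical in
/-- The upper bound in a graph with typical numbers of separators, typical degrees and, in the
dense case, the extension property. -/
theorem localizationNumber_le (h : InRange n p) (mayStay : Prop) (G : SimpleGraph (Fin n))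
    (hc0 : 0 < c) (hc1 : c < 1) {ε : ℝ} (hε0 : 0 < ε) (hε : ε ^ (2 - 2 * c) ≤ 1 / 256) {j : ℕ}
    (hj : 4 / ε ^ 2 ≤ 2 ^ j) (hjL : j + 1 ≤ Real.log n)
    (hsep : ∀ x y, x ≠ y → (1 - 1 / Real.log n ^ 2) * (2 * p * (1 - p)) * n
      ≤ ((separators G x y).card : ℝ))
    (hdeg : ∀ x, ((Finset.univ.filter fun w => G.Adj x w).card : ℝ) ≤ 3 * (n * p))
    (hext : ε ≤ p → ∀ B A : Finset (Fin n), B.card ≤ (2 ^ j) ^ 2 →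
      ∃ w, ∀ x ∈ B, G.Adj x w ↔ x ∈ A) :
    (localizationNumber mayStay G : ℝ) ≤ (1 - c * (Real.log (1 / p) / Real.log n)) *
      (2 * Real.log n / Real.log (1 / (p ^ 2 + (1 - p) ^ 2))) := by
  refine le_trans (Nat.cast_le.2 (Nat.sInf_le (s := {k | CopWins mayStay G k}) ?_))
    (Nat.floor_le (h.log_pos.le.trans (h.upper_bounds hc0 hc1).1))
  rcases le_total ε p with hεp | hεp
  · exact copWins_dense h mayStay G hc0 hc1 hε0 hj hjL hsep hεp (hext hεp)
  · exact copWins_sparse h mayStay G hc0 hc1 hε hsep hεp hdeg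

/-- The lower bound in a graph of diameter two in which each test set that is too small leaves
twins in each neighbourhood. -/
theorem le_localizationNumber (h : InRange n p) (mayStay : Prop) (G : SimpleGraph (Fin n)) {X : ℝ}
    (hX : X ≤ n) (hdiam : ∀ x y, x ≠ y → ∃ w, G.Adj w x ∧ G.Adj w y)
    (htwin : 0 < X → ∀ v, ∀ W : Finset (Fin n), W.card = ⌈X⌉₊ - 1 →
      ∃ x y, x ≠ y ∧ x ∉ W ∧ y ∉ W ∧ G.Adj v x ∧ G.Adj v y ∧ ∀ w ∈ W, G.Adj x w ↔ G.Adj y w) :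
    X ≤ localizationNumber mayStay G := by
  rcases le_or_gt X 0 with h0 | h0
  · exact h0.trans (Nat.cast_nonneg _)
  · have : Nonempty (Fin n) := ⟨⟨0, by exact_mod_cast h.cast_pos⟩⟩
    have hceil : ⌈X⌉₊ ≤ n := Nat.ceil_le.2 hX
    have hlt := lt_localizationNumber_of_twins mayStay G (⌈X⌉₊ - 1)
      (by rw [Fintype.card_fin]; omega) hdiam (htwin h0)
    have : ⌈X⌉₊ ≤ localizationNumber mayStay G := by omega
    exact (Nat.le_ceil X).trans (Nat.cast_le.2 this)

end FixedGraph

/-! ### The exceptional events are unlikely -/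

section Unlikely

open MeasureTheory

variable {n : ℕ} {p : unitInterval}

namespace InRange

theorem two_le {p : ℝ} (h : InRange n p) : 2 ≤ n := by
  have h1 := h.le_sqrt (i := 0) (by norm_num)
  have h2 := Real.sqrt_le_sqrt (Nat.cast_le (α := ℝ).2 (Nat.le_succ n))
  by_contra! hlt
  have h3 : √(n : ℝ) ≤ 1 := by
    rw [Real.sqrt_le_one]
    exact_mod_cast Nat.le_of_lt_succ hlt
  linarith

theorem one_div_eq {p : ℝ} (h : InRange n p) : 1 / (n : ℝ) = Real.exp (-Real.log n) := by
  rw [Real.exp_neg, h.exp_log, one_div]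

theorem pow_eq {p : ℝ} (h : InRange n p) (i : ℕ) : (n : ℝ) ^ i = Real.exp (i * Real.log n) := by
  rw [Real.exp_nat_mul, h.exp_log]

theorem measureReal_not_diam_two_le (h : InRange n p) {w : ℝ}
    (hw : 2 * Real.log n + w ≤ n * (p : ℝ) ^ 2) :
    (SimpleGraph.binomialRandom (Fin n) p).real
        {G | ¬ ∀ x y, x ≠ y → ∃ w, G.Adj w x ∧ G.Adj w y} ≤ Real.exp (2 - w) := by
  refine (LocalizationGame.measureReal_not_diam_two_le p h.two_le).trans ?_
  rw [h.pow_eq, ← Real.exp_add]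
  apply Real.exp_le_exp.2
  push_cast
  linarith

theorem measureReal_few_separators_le (h : InRange n p) :
    (SimpleGraph.binomialRandom (Fin n) p).real
        {G | ¬ ∀ x y, x ≠ y → (1 - 1 / Real.log n ^ 2) * (2 * p * (1 - p)) * n
          ≤ ((separators G x y).card : ℝ)} ≤ 1 / n := by
  have hL := h.log_pos
  have hL24 := h.log_ge
  refine (LocalizationGame.measureReal_few_separators_le p h.two_le (1 / Real.log n ^ 2)
    (by positivity) ?_).trans ?_
  · rw [div_le_one (by positivity)]
    exact one_le_pow₀ (by linarith)
  rw [h.pow_eq, ← Real.exp_add, h.one_div_eq]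
  apply Real.exp_le_exp.2
  have h1 : 4 * Real.log n ≤ (1 / Real.log n ^ 2) ^ 2 * (2 * p * (1 - p)) * n / 2 := by
    have h2 : √(n : ℝ) * (1 / Real.log n) ≤ (n * p) * (1 - p) :=
      mul_le_mul h.sqrt_le_mul h.le_q (by positivity) (by linarith [h.sqrt_le_mul, h.sqrt_pos])
    calc 4 * Real.log n = (4 * Real.log n ^ 6) * (1 / Real.log n) / Real.log n ^ 4 := by
          field_simp
      _ ≤ √(n : ℝ) * (1 / Real.log n) / Real.log n ^ 4 := by
          have := h.sqrt_ge
          gcongr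
      _ ≤ (n * p) * (1 - p) / Real.log n ^ 4 := by gcongr
      _ = _ := by field_simp
  push_cast
  linarith

open Classical in
theorem measureReal_large_degree_le (h : InRange n p) :
    (SimpleGraph.binomialRandom (Fin n) p).real
        {G | ¬ ∀ x, ((Finset.univ.filter fun w => G.Adj x w).card : ℝ) ≤ 3 * ((n : ℝ) * p)}
      ≤ 1 / n := by
  refine (LocalizationGame.measureReal_large_degree_le p).trans ?_
  have h1 := h.pow_eq 1
  rw [pow_one] at h1
  rw [h.one_div_eq]
  nth_rewrite 1 [h1]
  rw [← Real.exp_add]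
  apply Real.exp_le_exp.2
  have h2 := h.le_sqrt (i := 1) (by norm_num)
  have h3 := h.sqrt_le_mul
  have h4 := h.log_pos
  push_cast
  linarith

theorem measureReal_not_extension_le (h : InRange n p) (Q : ℕ)
    (hQ : (3 * Q + 1) * Real.log n ^ (Q + 1) ≤ n) (hp : 1 / Real.log n ≤ p) :
    (SimpleGraph.binomialRandom (Fin n) p).real
        {G | ¬ ∀ B A : Finset (Fin n), B.card ≤ Q → ∃ w, ∀ x ∈ B, G.Adj x w ↔ x ∈ A} ≤ 1 / n := by
  have hL := h.log_pos
  have hL24 := h.log_ge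
  have hn := h.cast_pos
  have hpow : 1 ≤ Real.log n ^ (Q + 1) := one_le_pow₀ (by linarith)
  have hQ0 : (0 : ℝ) ≤ Q := Nat.cast_nonneg Q
  have hQn : (Q : ℝ) ≤ n := by nlinarith
  refine (LocalizationGame.measureReal_not_extension_le p Q (by exact_mod_cast hQn)
    (by exact_mod_cast hn) (1 / Real.log n) (by positivity) hp h.le_q).trans ?_
  have h2 : (2 : ℝ) ≤ Real.exp 1 := by linarith [Real.add_one_le_exp (1 : ℝ)]
  have h3 : (2 * n : ℝ) ^ Q ≤ Real.exp (Q * (1 + Real.log n)) := by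
    rw [Real.exp_nat_mul, Real.exp_add, h.exp_log]
    gcongr
  rw [h.one_div_eq]
  refine (mul_le_mul_of_nonneg_right h3 (Real.exp_pos _).le).trans ?_
  rw [← Real.exp_add]
  apply Real.exp_le_exp.2
  have h4 : (2 * Q + 1) * Real.log n ≤ (n - Q) * (1 / Real.log n) ^ Q := by
    rw [one_div, inv_pow, ← div_eq_mul_inv, le_div_iff₀ (by positivity), mul_assoc, ← pow_succ']
    nlinarith
  nlinarith

/-- The number of test sets is at most `n ^ k = exp (O (log n ^ 3 / p))`, while the probability
that a given test set leaves no twins in a given neighbourhood is `exp (-Ω (log n ^ 4 / p))`. -/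
theorem measureReal_not_twins_le (h : InRange n p) {X : ℝ}
    (hX : X = (1 - 2 * (Real.log (1 / p) / Real.log n)
      - 4 * Real.log (Real.log n) / Real.log n) *
        (2 * Real.log n / Real.log (1 / ((p : ℝ) ^ 2 + (1 - p) ^ 2)))) (hX0 : 0 < X) :
    X ≤ n / 4 ∧ (SimpleGraph.binomialRandom (Fin n) p).real
        {G | ¬ ∀ v, ∀ W : Finset (Fin n), W.card = ⌈X⌉₊ - 1 → ∃ x y, x ≠ y ∧ x ∉ W ∧ y ∉ W ∧
          G.Adj v x ∧ G.Adj v y ∧ ∀ w ∈ W, G.Adj x w ↔ G.Adj y w} ≤ 1 / n := by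
  obtain ⟨ha, hal, -, hexp⟩ := log_one_div_rho_bounds h.p_pos h.p_lt_one
  obtain ⟨hs1, hs2, hs3⟩ := h.scale_le
  have hs0 := h.rho_scale_nonneg
  have hL := h.log_pos
  have hL24 := h.log_ge
  have hn := h.cast_pos
  have hp := h.p_pos
  have hη0 : 0 ≤ Real.log (1 / p) / Real.log n := div_nonneg h.log_one_div_p_nonneg hL.le
  have hLL : 0 ≤ Real.log (Real.log n) := Real.log_nonneg (by linarith)
  set L := Real.log n with hLdef
  set ℓ := Real.log (1 / ((p : ℝ) ^ 2 + (1 - p) ^ 2)) with hℓ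
  have hℓ0 : 0 < ℓ := ha.trans_le hal
  have hXL : X ≤ L ^ 2 / p := by
    have h1 : X ≤ 2 * L / ℓ := by
      rw [hX]
      refine mul_le_of_le_one_left hs0 ?_
      have : 0 ≤ 4 * Real.log L / L := by positivity
      linarith
    linarith
  refine ⟨hXL.trans hs3, ?_⟩
  set k := ⌈X⌉₊ - 1 with hk
  have hkX : (k : ℝ) ≤ X := by
    have h1 := Nat.ceil_lt_add_one hX0.le
    have h2 : 1 ≤ ⌈X⌉₊ := Nat.one_le_ceil_iff.2 hX0
    rw [hk, Nat.cast_sub h2, Nat.cast_one]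
    linarith
  -- `2 * m` samples outside `W ∪ {v}` are available, since `k ≤ n / 4`.
  set m := n / 3 with hm
  have hn24 : (24 : ℝ) ≤ n := by linarith [Real.log_le_sub_one_of_pos hn]
  have hn24' : 24 ≤ n := by exact_mod_cast hn24
  have hm4 : (n : ℝ) / 4 ≤ m := by
    have : n ≤ 4 * m := by omega
    have : (n : ℝ) ≤ 4 * m := by exact_mod_cast this
    linarith
  have hcard : 2 * m + k + 1 ≤ n := by
    have h1 : (k : ℝ) ≤ n / 4 := hkX.trans (hXL.trans hs3)
    have h2 : 4 * k ≤ n := by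
      have : (4 * k : ℝ) ≤ n := by linarith
      exact_mod_cast this
    omega
  have hmr : L ^ 4 / (4 * p) ≤ m * (L ^ 4 / (n * p)) := by
    calc L ^ 4 / (4 * p) = n / 4 * (L ^ 4 / (n * p)) := by field_simp
      _ ≤ _ := by gcongr
  have hp1 : (p : ℝ) ≤ 1 := p.2.2
  have hone : 1 ≤ L ^ 4 / (4 * p) := by
    rw [le_div_iff₀ (by positivity)]
    have : (24 : ℝ) ^ 4 ≤ L ^ 4 := by gcongr
    linarith
  refine (LocalizationGame.measureReal_not_twins_le p k m (L ^ 4 / (n * p)) ?_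
    (hone.trans hmr) hcard).trans ?_
  · -- `ρ ^ k ≥ ρ ^ X = (log n) ^ 8 / (n ^ 2 * p ^ 4)`
    have h1 : Real.exp (-(ℓ * X)) ≤ ((p : ℝ) ^ 2 + (1 - p) ^ 2) ^ k := by
      rw [← hexp, ← Real.exp_nat_mul]
      apply Real.exp_le_exp.2
      nlinarith
    have h2 : ℓ * X = 2 * L - 4 * Real.log (1 / p) - 8 * Real.log L := by
      rw [hX]
      field_simp
      ring
    have h3 : Real.exp (-(ℓ * X)) = L ^ 8 / (n ^ 2 * (p : ℝ) ^ 4) := by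
      have e1 : -(ℓ * X) = (8 : ℕ) * Real.log L - (2 : ℕ) * L - (4 : ℕ) * Real.log p := by
        rw [h2, one_div, Real.log_inv]
        push_cast
        ring
      rw [e1, Real.exp_sub, Real.exp_sub, Real.exp_nat_mul, Real.exp_nat_mul, Real.exp_nat_mul,
        Real.exp_log hL, Real.exp_log hp, h.exp_log, div_div]
    calc (L ^ 4 / (n * p)) ^ 2 = (p : ℝ) ^ 2 * (L ^ 8 / (n ^ 2 * (p : ℝ) ^ 4)) := by
          field_simp
      _ ≤ _ := by
          rw [← h3]
          exact mul_le_mul_of_nonneg_left h1 (sq_nonneg _)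
  · rw [h.pow_eq, ← Real.exp_add, h.one_div_eq]
    apply Real.exp_le_exp.2
    rw [← hLdef]
    have h1 : ((k + 1 : ℕ) : ℝ) * L ≤ L ^ 3 / p + L := by
      push_cast
      have : (k : ℝ) * L ≤ L ^ 2 / p * L := mul_le_mul_of_nonneg_right (hkX.trans hXL) hL.le
      calc _ = (k : ℝ) * L + L := by ring
        _ ≤ L ^ 2 / p * L + L := by linarith
        _ = _ := by ring
    have h2 : L ≤ L ^ 3 / p := by
      rw [le_div_iff₀ hp]
      nlinarith [mul_le_mul_of_nonneg_left hp1 hL.le, sq_nonneg (L - 1), pow_pos hL 2]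
    have h3 : 3 * (L ^ 3 / p) ≤ L ^ 4 / (4 * p) / 2 := by
      have : L ^ 4 / (4 * p) / 2 = L / 8 * (L ^ 3 / p) := by field_simp; norm_num
      rw [this]
      have : 0 ≤ L ^ 3 / p := by positivity
      gcongr
      linarith
    linarith

end InRange

end Unlikely

/-! ### Assembling the bounds -/

section Assembly

open MeasureTheory

/-- The probability that one of the two bounds fails; `exp (2 - w)` bounds the probability that the
diameter exceeds two, and each of the four other exceptional events has probability at most `1 / n`.
-/
theorem measureReal_bounds_fail_le {n : ℕ} {p : unitInterval} (h : InRange n p) (mayStay : Prop)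
    {w c ε : ℝ} (hw : 2 * Real.log n + w ≤ n * (p : ℝ) ^ 2) (hc0 : 0 < c) (hc1 : c < 1)
    (hε0 : 0 < ε) (hε : ε ^ (2 - 2 * c) ≤ 1 / 256) {j : ℕ} (hj : 4 / ε ^ 2 ≤ 2 ^ j)
    (hjL : j + 1 ≤ Real.log n) (hεL : 1 / Real.log n ≤ ε)
    (hQ : (3 * ((2 ^ j) ^ 2 : ℕ) + 1) * Real.log n ^ ((2 ^ j) ^ 2 + 1) ≤ n) :
    (SimpleGraph.binomialRandom (Fin n) p).real {G : SimpleGraph (Fin n) | ¬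
      ((1 - 2 * (Real.log (1 / p) / Real.log n) - 4 * Real.log (Real.log n) / Real.log n) *
          (2 * Real.log n / Real.log (1 / ((p : ℝ) ^ 2 + (1 - p) ^ 2)))
          ≤ (localizationNumber mayStay G : ℝ) ∧
        (localizationNumber mayStay G : ℝ) ≤ (1 - c * (Real.log (1 / p) / Real.log n)) *
          (2 * Real.log n / Real.log (1 / ((p : ℝ) ^ 2 + (1 - p) ^ 2))))}
      ≤ Real.exp (2 - w) + 4 * (1 / n) := by
  classical
  set X := (1 - 2 * (Real.log (1 / p) / Real.log n) - 4 * Real.log (Real.log n) / Real.log n) *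
          (2 * Real.log n / Real.log (1 / ((p : ℝ) ^ 2 + (1 - p) ^ 2))) with hX
  let diam (G : SimpleGraph (Fin n)) : Prop := ∀ x y, x ≠ y → ∃ w, G.Adj w x ∧ G.Adj w y
  let sep (G : SimpleGraph (Fin n)) : Prop := ∀ x y, x ≠ y →
    (1 - 1 / Real.log n ^ 2) * (2 * p * (1 - p)) * n ≤ ((separators G x y).card : ℝ)
  let deg (G : SimpleGraph (Fin n)) : Prop :=
    ∀ x, ((Finset.univ.filter fun w => G.Adj x w).card : ℝ) ≤ 3 * ((n : ℝ) * p)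
  let ext (G : SimpleGraph (Fin n)) : Prop := ∀ B A : Finset (Fin n), B.card ≤ (2 ^ j) ^ 2 →
    ∃ w, ∀ x ∈ B, G.Adj x w ↔ x ∈ A
  let twin (G : SimpleGraph (Fin n)) : Prop := ∀ v, ∀ W : Finset (Fin n), W.card = ⌈X⌉₊ - 1 →
    ∃ x y, x ≠ y ∧ x ∉ W ∧ y ∉ W ∧ G.Adj v x ∧ G.Adj v y ∧ ∀ w ∈ W, G.Adj x w ↔ G.Adj y w
  have hext : (SimpleGraph.binomialRandom (Fin n) p).real {G | ¬ (ε ≤ p → ext G)} ≤ 1 / n := by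
    by_cases hεp : ε ≤ p
    · simpa only [hεp, forall_true_left] using
        h.measureReal_not_extension_le ((2 ^ j) ^ 2) hQ (hεL.trans hεp)
    · simp [hεp]
  have htwin : (SimpleGraph.binomialRandom (Fin n) p).real {G | ¬ (0 < X → twin G)} ≤ 1 / n := by
    by_cases hX0 : 0 < X
    · simpa only [hX0, forall_true_left] using (h.measureReal_not_twins_le hX hX0).2
    · simp [hX0]
  have hXn : X ≤ n := by
    rcases le_or_gt X 0 with hX0 | hX0
    · exact hX0.trans (Nat.cast_nonneg n)
    · linarith [(h.measureReal_not_twins_le hX hX0).1, h.cast_pos]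
  refine (measureReal_mono (s₂ := {G | ¬ diam G} ∪ ({G | ¬ sep G} ∪ ({G | ¬ deg G} ∪
    ({G | ¬ (ε ≤ p → ext G)} ∪ {G | ¬ (0 < X → twin G)})))) ?_).trans ?_
  · intro G hG
    by_contra hcon
    simp only [Set.mem_union, Set.mem_ofPred_eq, not_or, not_not] at hcon
    obtain ⟨h1, h2, h3, h4, h5⟩ := hcon
    exact hG ⟨le_localizationNumber h mayStay G hXn h1 h5,
      localizationNumber_le h mayStay G hc0 hc1 hε0 hε hj hjL h2 h3 h4⟩
  · have h1 := h.measureReal_not_diam_two_le hw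
    have h2 := h.measureReal_few_separators_le
    have h3 := h.measureReal_large_degree_le
    have u1 := measureReal_union_le (μ := SimpleGraph.binomialRandom (Fin n) p) {G | ¬ diam G}
      ({G | ¬ sep G} ∪ ({G | ¬ deg G} ∪ ({G | ¬ (ε ≤ p → ext G)} ∪ {G | ¬ (0 < X → twin G)})))
    have u2 := measureReal_union_le (μ := SimpleGraph.binomialRandom (Fin n) p) {G | ¬ sep G}
      ({G | ¬ deg G} ∪ ({G | ¬ (ε ≤ p → ext G)} ∪ {G | ¬ (0 < X → twin G)}))
    have u3 := measureReal_union_le (μ := SimpleGraph.binomialRandom (Fin n) p) {G | ¬ deg G}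
      ({G | ¬ (ε ≤ p → ext G)} ∪ {G | ¬ (0 < X → twin G)})
    have u4 := measureReal_union_le (μ := SimpleGraph.binomialRandom (Fin n) p)
      {G | ¬ (ε ≤ p → ext G)} {G | ¬ (0 < X → twin G)}
    linarith

theorem eventually_mul_log_pow_le (C : ℝ) (hC : 0 < C) (i : ℕ) :
    ∀ᶠ n : ℕ in atTop, C * Real.log n ^ i ≤ n := by
  have h1 := (Real.isLittleO_pow_log_id_atTop (n := i)).comp_tendsto
    (tendsto_natCast_atTop_atTop (R := ℝ))
  filter_upwards [h1.bound (inv_pos.2 hC)] with n hn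
  simp only [Function.comp_apply, id, Real.norm_eq_abs] at hn
  rw [abs_of_nonneg (Nat.cast_nonneg (α := ℝ) n), inv_mul_eq_div, le_div_iff₀ hC] at hn
  linarith [mul_le_mul_of_nonneg_left (le_abs_self (Real.log n ^ i)) hC.le]

/-- The hypotheses on `p` in the form used above; the second part makes the diameter two. -/
theorem eventually_inRange (ω : ℕ → ℝ) (hω : Tendsto ω atTop atTop) (p : ℕ → unitInterval)
    (hp : ∀ᶠ n : ℕ in atTop,
      Real.sqrt ((2 * Real.log n + ω n) / n) ≤ (p n : ℝ) ∧
      (p n : ℝ) ≤ 1 - 3 * Real.log (Real.log n) / Real.log n) :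
    ∀ᶠ n : ℕ in atTop, InRange n (p n) ∧ 2 * Real.log n + ω n ≤ n * (p n : ℝ) ^ 2 := by
  have hlog : Tendsto (fun n : ℕ => Real.log n) atTop atTop :=
    Real.tendsto_log_atTop.comp tendsto_natCast_atTop_atTop
  filter_upwards [hp, hlog.eventually_ge_atTop 24, hω.eventually_ge_atTop 0,
    eventually_mul_log_pow_le 16 (by norm_num) 12,
    (Real.tendsto_log_atTop.comp hlog).eventually_ge_atTop 1, eventually_gt_atTop 0]
    with n hpn hL hω0 hpow hLL hn
  simp only [Function.comp_apply] at hLL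
  have hn' : (0 : ℝ) < n := Nat.cast_pos.2 hn
  refine ⟨⟨hL, ?_, ?_, ?_⟩, ?_⟩
  · apply Real.le_sqrt_of_sq_le
    calc ((4 * Real.log n ^ 6) ^ 2 : ℝ) = 16 * Real.log n ^ 12 := by ring
      _ ≤ (n : ℝ) := hpow
  · refine le_trans ?_ hpn.1
    rw [← Real.sqrt_one, ← Real.sqrt_div zero_le_one]
    apply Real.sqrt_le_sqrt
    gcongr
    linarith
  · have h1 : 1 / Real.log n ≤ 3 * Real.log (Real.log n) / Real.log n := by
      gcongr
      linarith
    linarith [hpn.2]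
  · have h1 := (Real.sqrt_le_left (p n).2.1).1 hpn.1
    rw [div_le_iff₀ hn'] at h1
    linarith

end Assembly

end LocalizationGame

theorem theorem2 (mayStay : Prop)
    (ω : ℕ → ℝ) (hω : Tendsto ω atTop atTop)
    (hω' : ω =o[atTop] fun n : ℕ => Real.log n)
    (p : ℕ → unitInterval)
    (hp : ∀ᶠ n : ℕ in atTop,
      Real.sqrt ((2 * Real.log n + ω n) / n) ≤ (p n : ℝ) ∧
      (p n : ℝ) ≤ 1 - 3 * Real.log (Real.log n) / Real.log n)
    (η : ℕ → ℝ) (hη : ∀ n, η n = Real.log (1 / (p n : ℝ)) / Real.log n)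
    (ρ : ℕ → ℝ) (hρ : ∀ n, ρ n = (p n : ℝ) ^ 2 + (1 - (p n : ℝ)) ^ 2)
    (c : ℝ) (hc0 : 0 < c)
    (hc : ∀ᶠ n : ℕ in atTop,
      c < min (1 / 2 * ((Real.log n - 3 * Real.log (Real.log n)) / Real.log (1 / (p n : ℝ)) - 1)) 1) :
    Tendsto
      (fun n : ℕ => SimpleGraph.binomialRandom (Fin n) (p n)
        {G : SimpleGraph (Fin n) |
          (1 - 2 * η n - 4 * Real.log (Real.log n) / Real.log n) *
              (2 * Real.log n / Real.log (1 / ρ n))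
            ≤ (LocalizationGame.localizationNumber mayStay G : ℝ) ∧
          (LocalizationGame.localizationNumber mayStay G : ℝ)
            ≤ (1 - c * η n) * (2 * Real.log n / Real.log (1 / ρ n))})
      atTop (𝓝 1) := by
  obtain ⟨n₀, hn₀⟩ := hc.exists
  have hc1 : c < 1 := lt_of_lt_of_le hn₀ (min_le_right _ _)
  -- The threshold between the sparse and the dense case, and the number of vertices of the test
  -- set that are chosen by hand in the dense case.
  obtain ⟨ε, hε0, hε⟩ : ∃ ε : ℝ, 0 < ε ∧ ε ^ (2 - 2 * c) ≤ 1 / 256 := by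
    refine ⟨(1 / 256) ^ (1 / (2 - 2 * c)), by positivity, ?_⟩
    rw [← Real.rpow_mul (by norm_num), one_div_mul_cancel (by linarith), Real.rpow_one]
  obtain ⟨j, hj⟩ := pow_unbounded_of_one_lt (4 / ε ^ 2) (one_lt_two (α := ℝ))
  have hlog : Tendsto (fun n : ℕ => Real.log n) atTop atTop :=
    Real.tendsto_log_atTop.comp tendsto_natCast_atTop_atTop
  have herr : Tendsto (fun n : ℕ => ENNReal.ofReal (1 - (Real.exp (2 - ω n) + 4 * (1 / n))))
      atTop (𝓝 1) := by
    have h1 : Tendsto (fun n => Real.exp (2 - ω n)) atTop (𝓝 0) :=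
      Real.tendsto_exp_atBot.comp (by
        simpa [sub_eq_add_neg] using
          tendsto_atBot_add_const_left atTop (2 : ℝ) (tendsto_neg_atTop_atBot.comp hω))
    have h2 : Tendsto (fun n : ℕ => 1 - (Real.exp (2 - ω n) + 4 * (1 / (n : ℝ)))) atTop (𝓝 1) := by
      simpa using tendsto_const_nhds.sub
        (h1.add (tendsto_one_div_atTop_nhds_zero_nat.const_mul (4 : ℝ))) (a := (1 : ℝ))
    simpa using ENNReal.tendsto_ofReal h2
  refine tendsto_of_tendsto_of_tendsto_of_le_of_le' herr tendsto_const_nhds ?_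
    (Eventually.of_forall fun n => MeasureTheory.prob_le_one)
  filter_upwards [LocalizationGame.eventually_inRange ω hω p hp,
    hlog.eventually_ge_atTop (j + 1), hlog.eventually_ge_atTop (1 / ε),
    LocalizationGame.eventually_mul_log_pow_le (3 * ((2 ^ j) ^ 2 : ℕ) + 1) (by positivity)
      ((2 ^ j) ^ 2 + 1)] with n hn hjL hεL hQ
  have hεL' : 1 / Real.log n ≤ ε := by
    rw [one_div_le hn.1.log_pos hε0]
    exact hεL
  have hfail := LocalizationGame.measureReal_bounds_fail_le hn.1 mayStay hn.2 hc0 hc1 hε0 hε hj.le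
    hjL hεL' hQ
  rw [hη n, hρ n]
  refine ENNReal.ofReal_le_of_le_toReal ?_
  have hcompl := MeasureTheory.probReal_compl_eq_one_sub
    (μ := SimpleGraph.binomialRandom (Fin n) (p n)) (LocalizationGame.measurableSet_graphs
      {G : SimpleGraph (Fin n) | ¬
      ((1 - 2 * (Real.log (1 / p n) / Real.log n) - 4 * Real.log (Real.log n) / Real.log n) *
          (2 * Real.log n / Real.log (1 / ((p n : ℝ) ^ 2 + (1 - p n) ^ 2)))
          ≤ (LocalizationGame.localizationNumber mayStay G : ℝ) ∧
        (LocalizationGame.localizationNumber mayStay G : ℝ) ≤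
          (1 - c * (Real.log (1 / p n) / Real.log n)) *
          (2 * Real.log n / Real.log (1 / ((p n : ℝ) ^ 2 + (1 - p n) ^ 2))))})
  rw [Set.compl_ofPred] at hcompl
  simp only [not_not] at hcompl
  rw [← MeasureTheory.measureReal_def, hcompl]
  linarith
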